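/- All graphs are finite, simple and undirected, and have two distinct distinguished vertices, a sender $s$ and a receiver $r$. An instruction in $G$ is a triple $uvw$ where $u\ne w$ are neighbours of $v$; a protocol $A$ is a set of instructions. An $A$-walk is a walk from $s$ to $r$ such that any three consecutive vertices $u,v,w$ of it form an instruction $uvw\in A$, and $A$ is finite if there are only finitely many $A$-walks. If every edge of $G$ survives independently with probability $p\in(0,1)$ and fails with probability $1-p$, then $\rho_A(G,p)$ denotes the probability that all edges of some $A$-walk survive, $\hat\rho(G,p)=\max\{\rho_A(G,p): A\text{ is a finite protocol for }G\}$, and $\rho(G,p)$ denotes the probability that $s$ and $r$ are joined by a path of surviving edges. A graph is series-parallel if it can be built from $K_2$ (with vertices $s,r$) by the series operation (identify the receiver of one graph with the sender of the next) and the parallel operation (identify the senders and identify the receivers of two graphs), all graphs remaining simple. The expansion of $G_1$ at an edge $xy$ by $H$ is obtained from $G_1-xy$ by identifying $s,r$ in $H$ with $x,y$, respectively. Let $B_0$ be the graph with vertices $s,1,2,3,4,5,r$ and edges $s1,s2,13,14,23,25,34,35,4r,5r$. A polynomial has profile $(m_1,\dots,m_t)$ if it is nonzero, has exactly $t$ zeros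 $z_1<\dots<z_t$ in $(0,1)$, and $z_i$ has multiplicity $m_i$. A function $f$ is piecewise polynomial on $(0,1)$ if there are $0=a_0<a_1<\dots<a_{n+1}=1$ such that $f$ agrees with a polynomial on each $[a_i,a_{i+1}]\cap(0,1)$. A breakpoint of order $m\ge1$ of $f$ is a point $z\in(0,1)$ at which $f$ is $m-1$ times differentiable but not $m$ times, where $0$ times differentiable means continuous. **Theorem.** For every $t\ge 0$ and every $t$-tuple $(m_1,\dots,m_t)$ of positive odd integers there are series-parallel graphs $H_1,H_2$ such that $\rho(H_1,p)-\rho(H_2,p)$ is a polynomial in $p$ with profile $(m_1,\dots,m_t)$, and such that the graph $G$ obtained from $B_0$ by expanding the edge $s1$ by $H_1$ and the edge $s2$ by $H_2$ (with $s$ in $H_1,H_2$ identified with $s$, and $r$ in $H_1,H_2$ identified with $1$ and $2$, respectively) has the following property: $\hat\rho(G,p)$ is piecewise polynomial in $p$ on $(0,1)$ and has exactly $t$ breakpoints $x_1<\dots<x_t$ in $(0,1)$, and $x_i$ has order $m_i$ for every $i$. -/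

import Mathlib

/-- A finite simple graph with two distinct distinguished vertices:
the sender `s` and the receiver `r`. -/
structure Network where
  V : Type
  finite : Finite V
  graph : SimpleGraph V
  s : V
  r : V
  s_ne_r : s ≠ r

namespace Network

instance (G : Network) : Finite G.V := G.finite

/-! ### Protocols -/

/-- A protocol is a set of instructions `uvw`, where `u ≠ w` are neighbours of `v`. -/
structure Protocol (G : Network) where
  instr : Set (G.V × G.V × G.V)
  valid : ∀ u v w, (u, v, w) ∈ instr → G.graph.Adj u v ∧ G.graph.Adj v w ∧ u ≠ w

/-- An `A`-walk: a walk from `s` to `r` such that every instruction it contains, that is, every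
three consecutive vertices of it, belongs to `A`. -/
def Protocol.IsWalk {G : Network} (A : G.Protocol) (W : G.graph.Walk G.s G.r) : Prop :=
  ∀ i, i + 2 ≤ W.length → (W.getVert i, W.getVert (i + 1), W.getVert (i + 2)) ∈ A.instr

/-- A protocol is finite if there are only finitely many `A`-walks. -/
def Protocol.IsFinite {G : Network} (A : G.Protocol) : Prop :=
  {W : G.graph.Walk G.s G.r | A.IsWalk W}.Finite

/-! ### Reliability -/

/-- The set of edges of the network. -/
noncomputable def edges (G : Network) : Finset (Sym2 G.V) :=
  (Set.toFinite G.graph.edgeSet).toFinset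

open Classical in
/-- The probability that the set `S` of surviving edges satisfies `Q`, if every edge `e`
survives with probability `p e` and fails with probability `1 - p e`, independently. -/
noncomputable def prob (G : Network) (p : Sym2 G.V → ℝ) (Q : Finset (Sym2 G.V) → Prop) : ℝ :=
  ∑ S ∈ G.edges.powerset with Q S, (∏ e ∈ S, p e) * ∏ e ∈ G.edges \ S, (1 - p e)

/-- The reliability of the protocol `A`: the probability that all edges of some `A`-walk
survive. -/
noncomputable def protocolReliability (G : Network) (p : Sym2 G.V → ℝ) (A : G.Protocol) : ℝ :=
  G.prob p fun S => ∃ W : G.graph.Walk G.s G.r, A.IsWalk W ∧ ∀ e ∈ W.edges, e ∈ S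

/-- The optimal reliability of finite protocols. The supremum is a maximum, see
`isGreatest_optimalReliability`. -/
noncomputable def optimalReliability (G : Network) (p : Sym2 G.V → ℝ) : ℝ :=
  sSup {x | ∃ A : G.Protocol, A.IsFinite ∧ G.protocolReliability p A = x}

/-- The two-terminal reliability: the probability that `s` and `r` lie in the same component of
the graph formed by the surviving edges. -/
noncomputable def reliability (G : Network) (p : Sym2 G.V → ℝ) : ℝ :=
  G.prob p fun S => (SimpleGraph.fromEdgeSet (S : Set (Sym2 G.V))).Reachable G.s G.r

instance (G : Network) : Finite G.Protocol :=
  Finite.of_injective (fun A : G.Protocol => A.instr) (by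
    rintro ⟨A, hA⟩ ⟨B, hB⟩ h
    cases h
    rfl)

theorem isGreatest_optimalReliability (G : Network) (p : Sym2 G.V → ℝ) :
    IsGreatest {x | ∃ A : G.Protocol, A.IsFinite ∧ G.protocolReliability p A = x}
      (G.optimalReliability p) := by
  have hfin : {x | ∃ A : G.Protocol, A.IsFinite ∧ G.protocolReliability p A = x}.Finite :=
    (Set.finite_range fun A : G.Protocol => G.protocolReliability p A).subset (by
      rintro x ⟨A, -, rfl⟩
      exact ⟨A, rfl⟩)
  have hne : {x | ∃ A : G.Protocol, A.IsFinite ∧ G.protocolReliability p A = x}.Nonempty := by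
    refine ⟨_, ⟨∅, fun u v w h => h.elim⟩, Set.Subsingleton.finite ?_, rfl⟩
    have len : ∀ W : G.graph.Walk G.s G.r,
        Protocol.IsWalk (G := G) ⟨∅, fun u v w h => h.elim⟩ W → W.length = 1 := by
      intro W hW
      have hlt : W.length < 2 := by
        by_contra hlen
        exact hW 0 (by omega)
      have hpos : W.length ≠ 0 := fun h0 => G.s_ne_r (SimpleGraph.Walk.eq_of_length_eq_zero h0)
      omega
    have key : ∀ {u v : G.V} (W : G.graph.Walk u v), W.length = 1 →
        ∃ h : G.graph.Adj u v, W = SimpleGraph.Walk.cons h SimpleGraph.Walk.nil := by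
      intro u v W h
      cases W with
      | nil => simp at h
      | cons e W =>
        cases W with
        | nil => exact ⟨e, rfl⟩
        | cons e2 W => simp at h
    intro W hW W' hW'
    obtain ⟨h, rfl⟩ := key W (len W hW)
    obtain ⟨h', rfl⟩ := key W' (len W' hW')
    rfl
  exact ⟨hne.csSup_mem hfin, fun x hx => le_csSup hfin.bddAbove hx⟩

/-! ### Gluing -/

/-- The vertices of `H` other than its two terminals. -/
abbrev Inner (H : Network) : Type := {v : H.V // v ≠ H.s ∧ v ≠ H.r}

open Classical in
/-- The map that identifies `s` and `r` in `H` with the vertices `x` and `y`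
and keeps the other vertices of `H` as new vertices. -/
noncomputable def glue (H : Network) {X : Type} (x y : X) (v : H.V) : X ⊕ H.Inner :=
  if hs : v = H.s then Sum.inl x
  else if hr : v = H.r then Sum.inl y
  else Sum.inr ⟨v, hs, hr⟩

/-- The expansion of `G` at its edge `xy` by `H`: the edge `xy` is removed from `G`, and `s`, `r`
in `H` are identified with `x`, `y`. -/
noncomputable abbrev expand (G : Network) (x y : G.V) (_h : G.graph.Adj x y) (H : Network) :
    Network where
  V := G.V ⊕ H.Inner
  finite := inferInstance
  graph := (G.graph.deleteEdges {s(x, y)}).map Sum.inl ⊔ H.graph.map (H.glue x y)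
  s := Sum.inl G.s
  r := Sum.inl G.r
  s_ne_r := fun h => G.s_ne_r (Sum.inl_injective h)

/-- The parallel operation: senders are identified, and receivers are identified. -/
noncomputable abbrev parallel (G H : Network) : Network where
  V := G.V ⊕ H.Inner
  finite := inferInstance
  graph := G.graph.map Sum.inl ⊔ H.graph.map (H.glue G.s G.r)
  s := Sum.inl G.s
  r := Sum.inl G.r
  s_ne_r := fun h => G.s_ne_r (Sum.inl_injective h)

open Classical in
/-- The series operation: the receiver of `G` is identified with the sender of `H`. -/
noncomputable abbrev series (G H : Network) : Network where
  V := G.V ⊕ {v : H.V // v ≠ H.s}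
  finite := inferInstance
  graph := G.graph.map Sum.inl ⊔
    H.graph.map (fun v => if hs : v = H.s then Sum.inl G.r else Sum.inr ⟨v, hs⟩)
  s := Sum.inl G.s
  r := Sum.inr ⟨H.r, H.s_ne_r.symm⟩
  s_ne_r := Sum.inl_ne_inr

/-- The complete graph on the two vertices `s` and `r`. -/
abbrev K2 : Network where
  V := Fin 2
  finite := inferInstance
  graph := ⊤
  s := 0
  r := 1
  s_ne_r := by decide

/-- Isomorphism of graphs that respects sender and receiver. -/
def Isomorphic (G H : Network) : Prop :=
  ∃ φ : G.graph ≃g H.graph, φ G.s = H.s ∧ φ G.r = H.r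

/-- Networks that can be built from `K2` by series and parallel operations. As all graphs are
simple, two networks that both have an edge `sr` may not be joined in parallel. -/
inductive IsSeriesParallel : Network → Prop
  | k2 : IsSeriesParallel K2
  | series {G H : Network} :
      IsSeriesParallel G → IsSeriesParallel H → IsSeriesParallel (G.series H)
  | parallel {G H : Network} :
      IsSeriesParallel G → IsSeriesParallel H →
      ¬ (G.graph.Adj G.s G.r ∧ H.graph.Adj H.s H.r) → IsSeriesParallel (G.parallel H)
  | iso {G H : Network} : IsSeriesParallel G → G.Isomorphic H → IsSeriesParallel H

/-! ### The graph `B₀` -/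

/-- The graph `B₀`. Its vertices `s, 1, 2, 3, 4, 5, r` are `0, 1, 2, 3, 4, 5, 6` here. -/
abbrev B0 : Network where
  V := Fin 7
  finite := inferInstance
  graph := SimpleGraph.fromEdgeSet
    {s(0, 1), s(0, 2), s(1, 3), s(1, 4), s(2, 3), s(2, 5), s(3, 4), s(3, 5), s(4, 6), s(5, 6)}
  s := (0 : Fin 7)
  r := (6 : Fin 7)
  s_ne_r := by decide

theorem B0_adj_s1 : B0.graph.Adj (0 : Fin 7) (1 : Fin 7) := by
  simp

theorem B0_expand_adj_s2 (H : Network) :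
    (B0.expand (0 : Fin 7) (1 : Fin 7) B0_adj_s1 H).graph.Adj
      (Sum.inl (0 : Fin 7)) (Sum.inl (2 : Fin 7)) := by
  refine Or.inl ⟨fun h => ?_, (0 : Fin 7), (2 : Fin 7), ?_, rfl, rfl⟩
  · exact absurd (Sum.inl_injective h) (show (0 : Fin 7) ≠ 2 by decide)
  · simp [SimpleGraph.deleteEdges]

/-- `B₀` with the edges `s1` and `s2` expanded by `H₁` and `H₂`; here `s` in `H₁` and `H₂` is
identified with `s`, and `r` in `H₁` and `H₂` with `1` and `2` respectively. -/
noncomputable abbrev expandB0 (H₁ H₂ : Network) : Network :=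
  (B0.expand (0 : Fin 7) (1 : Fin 7) B0_adj_s1 H₁).expand
    (Sum.inl (0 : Fin 7)) (Sum.inl (2 : Fin 7)) (B0_expand_adj_s2 H₁) H₂

end Network

/-! ### Profiles and breakpoints -/

/-- `f` is on `(0,1)` a polynomial that has profile `m`: it has exactly the zeros
`x₁ < ⋯ < xₜ` in `(0,1)`, and `xᵢ` has multiplicity `mᵢ`. -/
def HasProfile (f : ℝ → ℝ) {t : ℕ} (m : Fin t → ℕ) : Prop :=
  ∃ q : Polynomial ℝ, q ≠ 0 ∧ (∀ p ∈ Set.Ioo (0 : ℝ) 1, f p = q.eval p) ∧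
    ∃ x : Fin t → ℝ, StrictMono x ∧ {z ∈ Set.Ioo (0 : ℝ) 1 | q.IsRoot z} = Set.range x ∧
      ∀ i, q.rootMultiplicity (x i) = m i

/-- `f` is piecewise polynomial on `(0,1)`: there are points `0 = a₀ < a₁ < ⋯ < aₙ₊₁ = 1` such
that `f` is given by a polynomial on each interval `[aᵢ, aᵢ₊₁] ∩ (0,1)`. -/
def IsPiecewisePolynomial (f : ℝ → ℝ) : Prop :=
  ∃ (n : ℕ) (a : Fin (n + 2) → ℝ) (q : Fin (n + 1) → Polynomial ℝ),
    StrictMono a ∧ a 0 = 0 ∧ a (Fin.last (n + 1)) = 1 ∧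
      ∀ i, ∀ p ∈ Set.Icc (a i.castSucc) (a i.succ) ∩ Set.Ioo (0 : ℝ) 1, f p = (q i).eval p

/-- `f` is `k` times differentiable at `z` (not necessarily continuously);
`0` times differentiable means continuous. -/
def TimesDifferentiableAt : ℕ → (ℝ → ℝ) → ℝ → Prop
  | 0, f, z => ContinuousAt f z
  | 1, f, z => DifferentiableAt ℝ f z
  | k + 2, f, z => (∀ᶠ y in nhds z, DifferentiableAt ℝ f y) ∧
      TimesDifferentiableAt (k + 1) (deriv f) z

/-- `z ∈ (0,1)` is a breakpoint of order `m ≥ 1` of `f`: there, `f` is `m - 1` times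
differentiable, but not `m` times. -/
def IsBreakpointOfOrder (f : ℝ → ℝ) (m : ℕ) (z : ℝ) : Prop :=
  z ∈ Set.Ioo (0 : ℝ) 1 ∧ 1 ≤ m ∧ TimesDifferentiableAt (m - 1) f z ∧
    ¬ TimesDifferentiableAt m f z

/-- `z` is a breakpoint of `f`, of some order. -/
def IsBreakpoint (f : ℝ → ℝ) (z : ℝ) : Prop :=
  ∃ m, IsBreakpointOfOrder f m z

/-! ### Independent events -/

section Bernoulli

/-! Two routes through the expanded `B₀` are in conflict: 1,4,3,2,5,r, entered through H₁, and its
mirror image 2,5,3,1,4,r, entered through H₂. The first uses the directed edge 14 before 25, the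
second 25 before 14. An instruction sees only the last directed edge, so a protocol with walks along
both routes can be made to alternate between 14 and 25 for ever (`IsB0Expansion.not_isFinite`). A
finite protocol therefore fails either throughout the event `LostEvent`, in which only the first
route survives, or throughout its mirror image.

Conversely, losing one of these two events suffices. The directed edges are ranked so that every
other route ascends, and only ascending instructions are allowed; no directed edge is then repeated,
so the protocol is finite (`IsB0Expansion.exists_protocol`). Inside H₁ and H₂ the ranking comes from
a height function, which exists because they are series-parallel.

Writing ρ₁, ρ₂ for the reliabilities of H₁, H₂, the optimum is thus ρ(G,p) minus p⁵(1-p)³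
min(ρ₁(1-ρ₂), ρ₂(1-ρ₁)) (`IsB0Expansion.optimalReliability_eq`,
`IsB0Expansion.bernoulliProb_lostEvent`). The two arguments of the minimum differ by ρ₁-ρ₂. At a
zero of odd multiplicity m this changes sign, so the minimum switches between two polynomials whose
difference vanishes to order m: a breakpoint of order m. Elsewhere one polynomial applies locally.

It remains to realise a profile by ρ₁-ρ₂. Differences of series-parallel reliabilities are closed
under products (`IsReliabilityDifference.mul`), and y(1-y)(1-y-y²) with y = pⁿ is such a difference
with a single, simple zero in (0,1), which moves with n. Products of powers of these factors give
every profile (`exists_hasProfile`). -/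

open Classical in
/-- The probability that a random subset of `E`, which contains each element independently with
probability `p`, satisfies `Q`. -/
noncomputable def bernoulliProb {α : Type*} (E : Finset α) (p : ℝ) (Q : Finset α → Prop) : ℝ :=
  ∑ S ∈ E.powerset with Q S, (∏ _e ∈ S, p) * ∏ _e ∈ E \ S, (1 - p)

variable {α β γ : Type*}

theorem bernoulliProb_congr {E : Finset α} {p : ℝ} {Q Q' : Finset α → Prop}
    (h : ∀ S ⊆ E, Q S ↔ Q' S) : bernoulliProb E p Q = bernoulliProb E p Q' := by
  classical
  unfold bernoulliProb
  refine Finset.sum_congr (Finset.filter_congr fun S hS => ?_) fun _ _ => rfl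
  exact h S (Finset.mem_powerset.1 hS)

theorem bernoulliProb_mono {E : Finset α} {p : ℝ} (h0 : 0 ≤ p) (h1 : p ≤ 1)
    {Q Q' : Finset α → Prop} (h : ∀ S ⊆ E, Q S → Q' S) :
    bernoulliProb E p Q ≤ bernoulliProb E p Q' := by
  classical
  unfold bernoulliProb
  refine Finset.sum_le_sum_of_subset_of_nonneg ?_ fun S _ _ => ?_
  · intro S hS
    rw [Finset.mem_filter, Finset.mem_powerset] at hS ⊢
    exact ⟨hS.1, h S hS.1 hS.2⟩
  · exact mul_nonneg (Finset.prod_nonneg fun _ _ => h0)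
      (Finset.prod_nonneg fun _ _ => by linarith)

theorem bernoulliProb_true (E : Finset α) (p : ℝ) :
    bernoulliProb E p (fun _ => True) = 1 := by
  classical
  have h := Finset.prod_add (fun _ => p) (fun _ => 1 - p) E
  simp only [add_sub_cancel, Finset.prod_const_one] at h
  simpa [bernoulliProb] using h.symm

theorem bernoulliProb_add_and_not (E : Finset α) (p : ℝ) (Q R : Finset α → Prop) :
    bernoulliProb E p (fun S => Q S ∧ R S) + bernoulliProb E p (fun S => Q S ∧ ¬ R S) =
      bernoulliProb E p Q := by
  classical
  unfold bernoulliProb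
  rw [← Finset.sum_filter_add_sum_filter_not (E.powerset.filter Q) R]
  simp only [Finset.filter_filter]

theorem bernoulliProb_not (E : Finset α) (p : ℝ) (Q : Finset α → Prop) :
    bernoulliProb E p (fun S => ¬ Q S) = 1 - bernoulliProb E p Q := by
  have h := bernoulliProb_add_and_not E p (fun _ => True) Q
  simp only [true_and, bernoulliProb_true] at h
  linarith

theorem bernoulliProb_eq (E T : Finset α) (hT : T ⊆ E) (p : ℝ) :
    bernoulliProb E p (fun S => S = T) = p ^ T.card * (1 - p) ^ (E.card - T.card) := by
  classical
  unfold bernoulliProb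
  rw [Finset.sum_eq_single T]
  · simp [Finset.card_sdiff_of_subset hT]
  · intro S hS h
    simp at hS
    exact absurd hS.2 h
  · intro h
    simp [hT] at h

theorem exists_polynomial_bernoulliProb (E : Finset α) (Q : Finset α → Prop) :
    ∃ q : Polynomial ℝ, ∀ p, bernoulliProb E p Q = q.eval p := by
  classical
  refine ⟨∑ S ∈ E.powerset with Q S,
    (∏ _e ∈ S, Polynomial.X) * ∏ _e ∈ E \ S, (1 - Polynomial.X), fun p => ?_⟩
  simp [bernoulliProb, Polynomial.eval_finsetSum]

/-- Subsets of a disjoint union correspond to pairs of subsets, and the weights multiply. -/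
theorem bernoulliProb_mul [DecidableEq γ] {E₁ : Finset α} {E₂ : Finset β} {E : Finset γ}
    {f₁ : α → γ} {f₂ : β → γ} (h₁ : f₁.Injective) (h₂ : f₂.Injective)
    (hE : E = E₁.image f₁ ∪ E₂.image f₂) (hd : ∀ a ∈ E₁, ∀ b ∈ E₂, f₁ a ≠ f₂ b)
    {p : ℝ} {Q : Finset γ → Prop} {Q₁ : Finset α → Prop} {Q₂ : Finset β → Prop}
    (hQ : ∀ S₁ ⊆ E₁, ∀ S₂ ⊆ E₂, Q (S₁.image f₁ ∪ S₂.image f₂) ↔ Q₁ S₁ ∧ Q₂ S₂) :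
    bernoulliProb E p Q = bernoulliProb E₁ p Q₁ * bernoulliProb E₂ p Q₂ := by
  classical
  have hdis : ∀ S₁ ⊆ E₁, ∀ S₂ ⊆ E₂, Disjoint (S₁.image f₁) (S₂.image f₂) := by
    intro S₁ h S₂ h'
    rw [Finset.disjoint_left]
    simp only [Finset.mem_image]
    rintro _ ⟨a, ha, rfl⟩ ⟨b, hb, hab⟩
    exact hd a (h ha) b (h' hb) hab.symm
  have key : ∀ S₁ ⊆ E₁, ∀ S₂ ⊆ E₂, E \ (S₁.image f₁ ∪ S₂.image f₂) =
      (E₁ \ S₁).image f₁ ∪ (E₂ \ S₂).image f₂ := by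
    intro S₁ hS₁ S₂ hS₂
    ext e
    simp only [hE, Finset.mem_sdiff, Finset.mem_union, Finset.mem_image]
    constructor
    · rintro ⟨⟨a, ha, rfl⟩ | ⟨b, hb, rfl⟩, hn⟩
      · exact Or.inl ⟨a, ⟨ha, fun h => hn (Or.inl ⟨a, h, rfl⟩)⟩, rfl⟩
      · exact Or.inr ⟨b, ⟨hb, fun h => hn (Or.inr ⟨b, h, rfl⟩)⟩, rfl⟩
    · rintro (⟨a, ⟨ha, hn⟩, rfl⟩ | ⟨b, ⟨hb, hn⟩, rfl⟩)
      · refine ⟨Or.inl ⟨a, ha, rfl⟩, ?_⟩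
        rintro (⟨a', h, h'⟩ | ⟨b, h, h'⟩)
        · exact hn (h₁ h' ▸ h)
        · exact hd a ha b (hS₂ h) h'.symm
      · refine ⟨Or.inr ⟨b, hb, rfl⟩, ?_⟩
        rintro (⟨a, h, h'⟩ | ⟨b', h, h'⟩)
        · exact hd a (hS₁ h) b hb h'
        · exact hn (h₂ h' ▸ h)
  unfold bernoulliProb
  rw [Finset.sum_mul_sum, ← Finset.sum_product']
  symm
  refine Finset.sum_nbij' (fun x => x.1.image f₁ ∪ x.2.image f₂)
    (fun S => (E₁.filter fun e => f₁ e ∈ S, E₂.filter fun e => f₂ e ∈ S)) ?_ ?_ ?_ ?_ ?_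
  · rintro ⟨S₁, S₂⟩ h
    simp only [Finset.mem_product, Finset.mem_filter, Finset.mem_powerset] at h ⊢
    refine ⟨?_, (hQ _ h.1.1 _ h.2.1).2 ⟨h.1.2, h.2.2⟩⟩
    rw [hE]
    exact Finset.union_subset_union (Finset.image_subset_image h.1.1)
      (Finset.image_subset_image h.2.1)
  · intro S h
    simp only [Finset.mem_product, Finset.mem_filter, Finset.mem_powerset] at h ⊢
    have hS : (E₁.filter fun e => f₁ e ∈ S).image f₁ ∪ (E₂.filter fun e => f₂ e ∈ S).image f₂
        = S := by
      ext e
      simp only [Finset.mem_union, Finset.mem_image, Finset.mem_filter]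
      constructor
      · rintro (⟨a, h, rfl⟩ | ⟨a, h, rfl⟩) <;> exact h.2
      · intro he
        have := h.1 he
        simp only [hE, Finset.mem_union, Finset.mem_image] at this
        rcases this with ⟨a, ha, rfl⟩ | ⟨a, ha, rfl⟩
        · exact Or.inl ⟨a, ⟨ha, he⟩, rfl⟩
        · exact Or.inr ⟨a, ⟨ha, he⟩, rfl⟩
    have := (hQ _ (Finset.filter_subset (fun e => f₁ e ∈ S) E₁) _
      (Finset.filter_subset (fun e => f₂ e ∈ S) E₂)).1 (by rw [hS]; exact h.2)
    exact ⟨⟨Finset.filter_subset _ _, this.1⟩, Finset.filter_subset _ _, this.2⟩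
  · rintro ⟨S₁, S₂⟩ h
    simp only [Finset.mem_product, Finset.mem_filter, Finset.mem_powerset] at h
    simp only [Prod.mk.injEq]
    constructor
    · ext e
      simp only [Finset.mem_filter, Finset.mem_union, Finset.mem_image]
      constructor
      · rintro ⟨he, ⟨a, ha, h'⟩ | ⟨b, hb, h'⟩⟩
        · exact h₁ h' ▸ ha
        · exact absurd h'.symm (hd _ he _ (h.2.1 hb))
      · exact fun he => ⟨h.1.1 he, Or.inl ⟨e, he, rfl⟩⟩
    · ext e
      simp only [Finset.mem_filter, Finset.mem_union, Finset.mem_image]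
      constructor
      · rintro ⟨he, ⟨a, ha, h'⟩ | ⟨b, hb, h'⟩⟩
        · exact absurd h' (hd _ (h.1.1 ha) _ he)
        · exact h₂ h' ▸ hb
      · exact fun he => ⟨h.2.1 he, Or.inr ⟨e, he, rfl⟩⟩
  · intro S h
    simp only [Finset.mem_filter, Finset.mem_powerset] at h
    ext e
    simp only [Finset.mem_union, Finset.mem_image, Finset.mem_filter]
    constructor
    · rintro (⟨a, h, rfl⟩ | ⟨a, h, rfl⟩) <;> exact h.2
    · intro he
      have := h.1 he
      simp only [hE, Finset.mem_union, Finset.mem_image] at this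
      rcases this with ⟨a, ha, rfl⟩ | ⟨a, ha, rfl⟩
      · exact Or.inl ⟨a, ⟨ha, he⟩, rfl⟩
      · exact Or.inr ⟨a, ⟨ha, he⟩, rfl⟩
  · rintro ⟨S₁, S₂⟩ h
    simp only [Finset.mem_product, Finset.mem_filter, Finset.mem_powerset] at h
    have e1 := Finset.prod_union (f := fun _ => p) (hdis _ h.1.1 _ h.2.1)
    have e2 := Finset.prod_union (f := fun _ => 1 - p)
      (hdis _ (Finset.sdiff_subset (s := E₁) (t := S₁)) _ (Finset.sdiff_subset (s := E₂) (t := S₂)))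
    have e3 := key _ h.1.1 _ h.2.1
    simp only [Finset.prod_const, Finset.card_image_of_injective _ h₁,
      Finset.card_image_of_injective _ h₂] at e1 e2 ⊢
    have e4 : (E \ (S₁.image f₁ ∪ S₂.image f₂)).card =
      ((E₁ \ S₁).image f₁ ∪ (E₂ \ S₂).image f₂).card := by rw [← e3]
    trans p ^ (S₁.image f₁ ∪ S₂.image f₂).card *
      (1 - p) ^ (E \ (S₁.image f₁ ∪ S₂.image f₂)).card
    · rw [e4, e1, e2]
      ring
    · congr!

end Bernoulli

/-! ### Connection by a set of edges -/

/-- The vertices `u` and `v` are connected by edges from `S`. -/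
def EdgeConn {V : Type*} (S : Set (Sym2 V)) : V → V → Prop :=
  Relation.ReflTransGen fun x y => s(x, y) ∈ S

theorem reachable_fromEdgeSet_iff {V : Type*} (S : Set (Sym2 V)) (u v : V) :
    (SimpleGraph.fromEdgeSet S).Reachable u v ↔ EdgeConn S u v := by
  rw [SimpleGraph.reachable_iff_reflTransGen]
  constructor
  · exact Relation.ReflTransGen.mono (fun x y h => ((SimpleGraph.fromEdgeSet_adj S).1 h).1) u v
  · intro h
    induction h with
    | refl => exact .refl
    | @tail b c _ h ih =>
      by_cases hbc : b = c
      · exact hbc ▸ ih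
      · exact ih.tail ((SimpleGraph.fromEdgeSet_adj S).2 ⟨h, hbc⟩)

theorem EdgeConn.invariant {V : Type*} {S : Set (Sym2 V)} {u v : V} (h : EdgeConn S u v)
    {P : V → Prop} (h0 : P u) (hP : ∀ x y, s(x, y) ∈ S → P x → P y) : P v := by
  induction h with
  | refl => exact h0
  | tail _ h ih => exact hP _ _ h ih

theorem EdgeConn.map {V W : Type*} {S : Set (Sym2 V)} {T : Set (Sym2 W)} {f : V → W}
    (hf : ∀ e ∈ S, Sym2.map f e ∈ T) {u v : V} (h : EdgeConn S u v) :
    EdgeConn T (f u) (f v) :=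
  Relation.ReflTransGen.lift f (fun x y hxy => hf s(x, y) hxy) _ _ h

namespace Network

theorem mem_edges (G : Network) (e : Sym2 G.V) : e ∈ G.edges ↔ e ∈ G.graph.edgeSet := by
  simp [edges]

theorem prob_eq (G : Network) (p : ℝ) (Q : Finset (Sym2 G.V) → Prop) :
    G.prob (fun _ => p) Q = bernoulliProb G.edges p Q := by
  unfold prob bernoulliProb
  congr!

theorem reliability_eq (G : Network) (p : ℝ) :
    G.reliability (fun _ => p) = bernoulliProb G.edges p fun S => EdgeConn (S : Set _) G.s G.r :=
  (prob_eq _ _ _).trans (bernoulliProb_congr fun _ _ => reachable_fromEdgeSet_iff _ _ _)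

theorem protocolReliability_eq (G : Network) (p : ℝ) (A : G.Protocol) :
    G.protocolReliability (fun _ => p) A = bernoulliProb G.edges p fun S =>
      ∃ W : G.graph.Walk G.s G.r, A.IsWalk W ∧ ∀ e ∈ W.edges, e ∈ S :=
  prob_eq _ _ _

end Network

/-! ### Series-parallel networks -/

section Gluing

variable {U V W : Type*} {a : U → W} {b : V → W} {s₁ r₁ : U} {s₂ r₂ : V}
  {S₁ : Set (Sym2 U)} {S₂ : Set (Sym2 V)} {S : Set (Sym2 W)}

/-- The glued vertex is a cut vertex: the second part can be reached only after `r₁` has been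
reached inside the first. -/
theorem edgeConn_series (ha : a.Injective) (hb : b.Injective)
    (hab : ∀ x y, a x = b y ↔ x = r₁ ∧ y = s₂) (h₁ : s₁ ≠ r₁)
    (hS : S = Sym2.map a '' S₁ ∪ Sym2.map b '' S₂) :
    EdgeConn S (a s₁) (b r₂) ↔ EdgeConn S₁ s₁ r₁ ∧ EdgeConn S₂ s₂ r₂ := by
  subst hS
  constructor
  · intro h
    refine (h.invariant (P := fun v => (∀ x, v = a x → EdgeConn S₁ s₁ x) ∧
      ∀ y, v = b y → EdgeConn S₁ s₁ r₁ ∧ EdgeConn S₂ s₂ y) ?_ ?_).2 r₂ rfl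
    · refine ⟨fun x hx => ha hx ▸ .refl, fun y hy => absurd ((hab _ _).1 hy).1 h₁⟩
    · rintro x y (⟨e, he, h⟩ | ⟨e, he, h⟩) ⟨hx₁, hx₂⟩
      · induction e with | _ u v
        wlog huv : a u = x ∧ a v = y generalizing u v
        · refine this v u (Sym2.eq_swap ▸ he) (Sym2.eq_swap ▸ h) ?_
          rw [Sym2.map_mk, Sym2.eq_iff] at h
          tauto
        obtain ⟨rfl, rfl⟩ := huv
        have hv : EdgeConn S₁ s₁ v := (hx₁ u rfl).tail he
        refine ⟨fun x hx => ha hx ▸ hv, fun y hy => ?_⟩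
        obtain ⟨rfl, rfl⟩ := (hab _ _).1 hy
        exact ⟨hv, .refl⟩
      · induction e with | _ u v
        wlog huv : b u = x ∧ b v = y generalizing u v
        · refine this v u (Sym2.eq_swap ▸ he) (Sym2.eq_swap ▸ h) ?_
          rw [Sym2.map_mk, Sym2.eq_iff] at h
          tauto
        obtain ⟨rfl, rfl⟩ := huv
        obtain ⟨hr, hu⟩ := hx₂ u rfl
        refine ⟨fun x hx => ?_, fun y hy => hb hy ▸ ⟨hr, hu.tail he⟩⟩
        obtain ⟨rfl, rfl⟩ := (hab _ _).1 hx.symm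
        exact hr
  · rintro ⟨h, h'⟩
    have h1 := h.map (T := Sym2.map a '' S₁ ∪ Sym2.map b '' S₂) (f := a)
      fun e he => Or.inl ⟨e, he, rfl⟩
    have h2 := h'.map (T := Sym2.map a '' S₁ ∪ Sym2.map b '' S₂) (f := b)
      fun e he => Or.inr ⟨e, he, rfl⟩
    rw [(hab r₁ s₂).2 ⟨rfl, rfl⟩] at h1
    exact h1.trans h2

/-- If neither part joins its terminals, the vertices reached from the sender within each part form
a set that no edge leaves, since the parts meet only in terminals. -/
theorem edgeConn_parallel (ha : a.Injective) (hb : b.Injective)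
    (hab : ∀ x y, a x = b y ↔ x = s₁ ∧ y = s₂ ∨ x = r₁ ∧ y = r₂)
    (hS : S = Sym2.map a '' S₁ ∪ Sym2.map b '' S₂) :
    EdgeConn S (a s₁) (a r₁) ↔ EdgeConn S₁ s₁ r₁ ∨ EdgeConn S₂ s₂ r₂ := by
  subst hS
  constructor
  · intro h
    by_contra! hn
    refine hn.1 <| (h.invariant (P := fun v => (∀ x, v = a x → EdgeConn S₁ s₁ x) ∧
      ∀ y, v = b y → EdgeConn S₂ s₂ y) ?_ ?_).1 r₁ rfl
    · refine ⟨fun x hx => ha hx ▸ .refl, fun y hy => ?_⟩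
      rcases (hab _ _).1 hy with ⟨-, rfl⟩ | ⟨h, -⟩
      · exact .refl
      · exact absurd (h ▸ .refl) hn.1
    · rintro x y (⟨e, he, h⟩ | ⟨e, he, h⟩) ⟨hx₁, hx₂⟩
      · induction e with | _ u v
        wlog huv : a u = x ∧ a v = y generalizing u v
        · refine this v u (Sym2.eq_swap ▸ he) (Sym2.eq_swap ▸ h) ?_
          rw [Sym2.map_mk, Sym2.eq_iff] at h
          tauto
        obtain ⟨rfl, rfl⟩ := huv
        have hv : EdgeConn S₁ s₁ v := (hx₁ u rfl).tail he
        refine ⟨fun x hx => ha hx ▸ hv, fun y hy => ?_⟩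
        rcases (hab _ _).1 hy with ⟨rfl, rfl⟩ | ⟨rfl, rfl⟩
        · exact .refl
        · exact absurd hv hn.1
      · induction e with | _ u v
        wlog huv : b u = x ∧ b v = y generalizing u v
        · refine this v u (Sym2.eq_swap ▸ he) (Sym2.eq_swap ▸ h) ?_
          rw [Sym2.map_mk, Sym2.eq_iff] at h
          tauto
        obtain ⟨rfl, rfl⟩ := huv
        have hv : EdgeConn S₂ s₂ v := (hx₂ u rfl).tail he
        refine ⟨fun x hx => ?_, fun y hy => hb hy ▸ hv⟩
        rcases (hab _ _).1 hx.symm with ⟨rfl, rfl⟩ | ⟨rfl, rfl⟩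
        · exact .refl
        · exact absurd hv hn.2
  · rintro (h | h)
    · exact h.map fun e he => Or.inl ⟨e, he, rfl⟩
    · have h2 := h.map (T := Sym2.map a '' S₁ ∪ Sym2.map b '' S₂) (f := b)
        fun e he => Or.inr ⟨e, he, rfl⟩
      rwa [← (hab s₁ s₂).2 (Or.inl ⟨rfl, rfl⟩), ← (hab r₁ r₂).2 (Or.inr ⟨rfl, rfl⟩)] at h2

end Gluing

/-! ### Reliability under series and parallel composition -/

namespace Network

theorem edgeSet_map_of_injective {V W : Type*} {f : V → W} (hf : f.Injective)
    (G : SimpleGraph V) : (G.map f).edgeSet = Sym2.map f '' G.edgeSet :=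
  SimpleGraph.edgeSet_map ⟨f, hf⟩ G

theorem glue_eq_inl_iff {H : Network} {X : Type} {x y : X} (z : X) (v : H.V) :
    Sum.inl z = H.glue x y v ↔ z = x ∧ v = H.s ∨ z = y ∧ v = H.r := by
  have := H.s_ne_r
  unfold glue
  split_ifs with h1 h2
  · subst h1; simp [this]
  · subst h2; simp [this.symm]
  · simp [h1, h2]

theorem glue_injective (H : Network) {X : Type} {x y : X} (h : x ≠ y) :
    (H.glue x y).Injective := by
  intro u v huv
  unfold glue at huv
  split_ifs at huv <;> simp_all

theorem glue_s (H : Network) {X : Type} (x y : X) : H.glue x y H.s = Sum.inl x := by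
  simp [glue]

theorem glue_r (H : Network) {X : Type} (x y : X) : H.glue x y H.r = Sum.inl y := by
  simp [glue, H.s_ne_r.symm]

open Classical in
/-- The map that identifies the sender of `H` with the vertex `x`. -/
noncomputable def glueSender (H : Network) {X : Type} (x : X) (v : H.V) :
    X ⊕ {v : H.V // v ≠ H.s} :=
  if hs : v = H.s then Sum.inl x else Sum.inr ⟨v, hs⟩

theorem glueSender_eq_inl_iff {H : Network} {X : Type} {x : X} (z : X) (v : H.V) :
    Sum.inl z = H.glueSender x v ↔ z = x ∧ v = H.s := by
  unfold glueSender
  split_ifs with h1 <;> simp [h1]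

theorem glueSender_injective (H : Network) {X : Type} (x : X) :
    (H.glueSender x).Injective := by
  intro u v huv
  unfold glueSender at huv
  split_ifs at huv <;> simp_all

theorem glueSender_r (H : Network) {X : Type} (x : X) :
    H.glueSender x H.r = Sum.inr ⟨H.r, H.s_ne_r.symm⟩ := by
  simp [glueSender, H.s_ne_r.symm]

theorem edgeSet_series (G H : Network) : (G.series H).graph.edgeSet =
    Sym2.map Sum.inl '' G.graph.edgeSet ∪ Sym2.map (H.glueSender G.r) '' H.graph.edgeSet := by
  rw [← edgeSet_map_of_injective Sum.inl_injective,
    ← edgeSet_map_of_injective (H.glueSender_injective G.r), ← SimpleGraph.edgeSet_sup]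
  rfl

theorem edgeSet_parallel (G H : Network) : (G.parallel H).graph.edgeSet =
    Sym2.map Sum.inl '' G.graph.edgeSet ∪ Sym2.map (H.glue G.s G.r) '' H.graph.edgeSet := by
  rw [← edgeSet_map_of_injective Sum.inl_injective,
    ← edgeSet_map_of_injective (H.glue_injective G.s_ne_r), ← SimpleGraph.edgeSet_sup]

/-- Edges with a common image under two maps have at least two identified end vertices each. -/
theorem exists_identified_of_map_eq {U V W : Type*} {a : U → W} {b : V → W}
    {G : SimpleGraph U} {H : SimpleGraph V} {e : Sym2 U} {f : Sym2 V}
    (he : e ∈ G.edgeSet) (hf : f ∈ H.edgeSet) (h : Sym2.map a e = Sym2.map b f) :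
    ∃ x x' y y', G.Adj x x' ∧ H.Adj y y' ∧ a x = b y ∧ a x' = b y' := by
  induction e with | _ x x'
  induction f with | _ y y'
  rw [Sym2.map_mk, Sym2.map_mk, Sym2.eq_iff] at h
  rcases h with ⟨h1, h2⟩ | ⟨h1, h2⟩
  · exact ⟨x, x', y, y', he, hf, h1, h2⟩
  · exact ⟨x, x', y', y, he, SimpleGraph.Adj.symm hf, h1, h2⟩

theorem reliability_series (G H : Network) (p : ℝ) :
    (G.series H).reliability (fun _ => p) =
      G.reliability (fun _ => p) * H.reliability (fun _ => p) := by
  classical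
  simp only [reliability_eq]
  refine bernoulliProb_mul (Sym2.map.injective Sum.inl_injective)
    (Sym2.map.injective (H.glueSender_injective G.r)) ?_ ?_ ?_
  · ext e
    refine (mem_edges _ _).trans ?_
    rw [edgeSet_series]
    simp only [mem_edges, Finset.mem_union, Finset.mem_image, Set.mem_union, Set.mem_image]
  · intro e he f hf h
    rw [mem_edges] at he hf
    obtain ⟨x, x', y, y', hx, hy, h1, h2⟩ :=
      exists_identified_of_map_eq he hf h
    rw [glueSender_eq_inl_iff] at h1 h2
    exact hx.ne (h1.1.trans h2.1.symm)
  · intro S₁ _ S₂ _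
    rw [← edgeConn_series (a := (Sum.inl : G.V → G.V ⊕ {v // v ≠ H.s}))
      (b := H.glueSender G.r) Sum.inl_injective (H.glueSender_injective G.r)
      glueSender_eq_inl_iff G.s_ne_r rfl, glueSender_r]
    simp only [Finset.coe_union, Finset.coe_image]

/-- Failure probabilities multiply. The two edge sets are disjoint unless both parts contain the
edge sr, the only edge that gluing could identify. -/
theorem reliability_parallel (G H : Network) (p : ℝ)
    (hGH : ¬ (G.graph.Adj G.s G.r ∧ H.graph.Adj H.s H.r)) :
    1 - (G.parallel H).reliability (fun _ => p) =
      (1 - G.reliability (fun _ => p)) * (1 - H.reliability (fun _ => p)) := by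
  classical
  simp only [reliability_eq, ← bernoulliProb_not]
  refine bernoulliProb_mul (Sym2.map.injective Sum.inl_injective)
    (Sym2.map.injective (H.glue_injective G.s_ne_r)) ?_ ?_ ?_
  · ext e
    refine (mem_edges _ _).trans ?_
    rw [edgeSet_parallel]
    simp only [mem_edges, Finset.mem_union, Finset.mem_image, Set.mem_union, Set.mem_image]
  · intro e he f hf h
    rw [mem_edges] at he hf
    obtain ⟨x, x', y, y', hx, hy, h1, h2⟩ :=
      exists_identified_of_map_eq he hf h
    rw [glue_eq_inl_iff] at h1 h2
    rcases h1 with ⟨rfl, rfl⟩ | ⟨rfl, rfl⟩ <;> rcases h2 with ⟨rfl, rfl⟩ | ⟨rfl, rfl⟩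
    · exact hx.ne rfl
    · exact hGH ⟨hx, hy⟩
    · exact hGH ⟨hx.symm, hy.symm⟩
    · exact hx.ne rfl
  · intro S₁ _ S₂ _
    rw [← not_or, ← edgeConn_parallel (a := (Sum.inl : G.V → G.V ⊕ H.Inner))
      (b := H.glue G.s G.r) Sum.inl_injective (H.glue_injective G.s_ne_r)
      glue_eq_inl_iff rfl]
    simp only [Finset.coe_union, Finset.coe_image]

theorem not_adj_series (G H : Network) :
    ¬ (G.series H).graph.Adj (G.series H).s (G.series H).r := by
  rintro (⟨-, x, y, -, h, h'⟩ | ⟨-, x, y, -, h, h'⟩)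
  · exact Sum.inl_ne_inr h'
  · exact G.s_ne_r ((glueSender_eq_inl_iff (H := H) _ _).1 h.symm).1

theorem reliability_K2 (p : ℝ) : K2.reliability (fun _ => p) = p := by
  have hE : K2.edges = {s(0, 1)} := by
    ext e
    rw [mem_edges]
    induction e with | _ x y
    fin_cases x <;> fin_cases y <;> simp
  rw [reliability_eq, hE, bernoulliProb_congr (Q' := fun S => S = {s((0 : Fin 2), 1)}),
    bernoulliProb_eq _ _ subset_rfl]
  · simp
  · intro S hS
    rcases Finset.subset_singleton_iff.1 hS with rfl | rfl
    · constructor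
      · intro h
        exact absurd (h.invariant (P := fun v => v = 0) rfl (by simp)) (by decide)
      · intro h
        exact absurd h.symm (Finset.singleton_ne_empty _)
    · simp only [iff_true]
      exact .single (by simp)

/-! ### Height functions on series-parallel networks -/

/-- The vertices of `H` have heights such that two terminals connected by a set of edges
are connected by an ascending path in it. -/
def HasHeight (H : Network) (φ : H.V → ℝ) : Prop :=
  φ H.s = 0 ∧ φ H.r = 1 ∧ (∀ v, 0 ≤ φ v ∧ φ v ≤ 1) ∧
    ∀ S ⊆ H.graph.edgeSet, EdgeConn S H.s H.r →
      Relation.ReflTransGen (fun u v => s(u, v) ∈ S ∧ φ u < φ v) H.s H.r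

theorem hasHeight_K2 : ∃ φ, K2.HasHeight φ := by
  refine ⟨fun v => if v = (0 : Fin 2) then 0 else 1, if_pos rfl, if_neg (by decide), ?_, ?_⟩
  · intro v
    dsimp only
    split_ifs <;> norm_num
  · intro S _ h
    refine .single ⟨?_, ?_⟩
    · by_contra hn
      refine absurd (h.invariant (P := fun v => v = (0 : Fin 2)) rfl ?_) (by decide)
      rintro x y hxy rfl
      by_contra hy
      rcases Fin.exists_fin_two.1 ⟨y, rfl⟩ with rfl | rfl
      · exact hy rfl
      · exact hn hxy
    · simp

theorem eq_image_union_image {α β γ : Type*} {f : α → γ} {g : β → γ} {A : Set α} {B : Set β}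
    {S : Set γ} (hS : S ⊆ f '' A ∪ g '' B) :
    S = f '' {e | e ∈ A ∧ f e ∈ S} ∪ g '' {e | e ∈ B ∧ g e ∈ S} := by
  ext e
  constructor
  · intro he
    rcases hS he with ⟨f, hf, rfl⟩ | ⟨f, hf, rfl⟩
    · exact Or.inl ⟨f, ⟨hf, he⟩, rfl⟩
    · exact Or.inr ⟨f, ⟨hf, he⟩, rfl⟩
  · rintro (⟨f, hf, rfl⟩ | ⟨f, hf, rfl⟩) <;> exact hf.2

/-- The heights of the two parts are compressed into [0,1/2] and [1/2,1], so ascending paths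
concatenate. -/
theorem HasHeight.series {G H : Network} {φ : G.V → ℝ} {ψ : H.V → ℝ} (hφ : G.HasHeight φ)
    (hψ : H.HasHeight ψ) :
    (G.series H).HasHeight (Sum.elim (fun v => φ v / 2) fun v => (1 + ψ v) / 2) := by
  obtain ⟨φs, φr, φb, φm⟩ := hφ
  obtain ⟨ψs, ψr, ψb, ψm⟩ := hψ
  have hψ' : ∀ v, Sum.elim (fun v => φ v / 2) (fun v : {v // v ≠ H.s} => (1 + ψ v) / 2)
      (H.glueSender G.r v) = (1 + ψ v) / 2 := by
    intro v
    unfold glueSender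
    split_ifs with h
    · simp [h, ψs, φr]
    · rfl
  refine ⟨by simp [φs], by simp [ψr], ?_, ?_⟩
  · rintro (v | v)
    · have := φb v
      constructor <;> simp <;> linarith
    · have := ψb v
      constructor <;> simp <;> linarith
  · intro S hS h
    have hS' := eq_image_union_image (hS.trans (edgeSet_series G H).subset)
    have h' := h
    change EdgeConn S (Sum.inl G.s) (Sum.inr _) at h'
    rw [← H.glueSender_r G.r, edgeConn_series Sum.inl_injective (H.glueSender_injective G.r)
      glueSender_eq_inl_iff G.s_ne_r hS'] at h'
    have m1 := φm _ (fun _ he => he.1) h'.1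
    have m2 := ψm _ (fun _ he => he.1) h'.2
    have h1 := Relation.ReflTransGen.lift (p := fun u v => s(u, v) ∈ S ∧
      Sum.elim (fun v => φ v / 2) (fun v : {v // v ≠ H.s} => (1 + ψ v) / 2) u <
      Sum.elim (fun v => φ v / 2) (fun v : {v // v ≠ H.s} => (1 + ψ v) / 2) v)
      (Sum.inl) (fun x y hxy => ⟨hxy.1.2, by
        have := hxy.2
        simp only [Sum.elim_inl]
        linarith⟩) _ _ m1
    have h2 := Relation.ReflTransGen.lift (p := fun u v => s(u, v) ∈ S ∧
      Sum.elim (fun v => φ v / 2) (fun v : {v // v ≠ H.s} => (1 + ψ v) / 2) u <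
      Sum.elim (fun v => φ v / 2) (fun v : {v // v ≠ H.s} => (1 + ψ v) / 2) v)
      (H.glueSender G.r) (fun x y hxy => ⟨hxy.1.2, by
        have := hxy.2
        simp only [hψ']
        linarith⟩) _ _ m2
    have h3 := (glueSender_eq_inl_iff (H := H) (x := G.r) G.r H.s).2 ⟨rfl, rfl⟩
    rw [Function.onFun, ← h3, glueSender_r] at h2
    exact h1.trans h2

theorem HasHeight.parallel {G H : Network} {φ : G.V → ℝ} {ψ : H.V → ℝ} (hφ : G.HasHeight φ)
    (hψ : H.HasHeight ψ) :
    (G.parallel H).HasHeight (Sum.elim φ fun v => ψ v) := by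
  obtain ⟨φs, φr, φb, φm⟩ := hφ
  obtain ⟨ψs, ψr, ψb, ψm⟩ := hψ
  have hψ' : ∀ v, Sum.elim φ (fun v : H.Inner => ψ v) (H.glue G.s G.r v) = ψ v := by
    intro v
    unfold glue
    split_ifs with h h'
    · simp [h, ψs, φs]
    · simp [h', ψr, φr]
    · rfl
  refine ⟨by simp [φs], by simp [φr], ?_, ?_⟩
  · rintro (v | v)
    · exact φb v
    · exact ψb v
  · intro S hS h
    have hS' := eq_image_union_image (hS.trans (edgeSet_parallel G H).subset)
    have h' := h
    rw [edgeConn_parallel Sum.inl_injective (H.glue_injective G.s_ne_r)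
      glue_eq_inl_iff hS'] at h'
    rcases h' with h' | h'
    · have m1 := φm _ (fun _ he => he.1) h'
      exact Relation.ReflTransGen.lift
        (p := fun u v => s(u, v) ∈ S ∧
        Sum.elim φ (fun v : H.Inner => ψ v) u < Sum.elim φ (fun v : H.Inner => ψ v) v)
        (Sum.inl) (fun x y hxy => ⟨hxy.1.2, by simpa using hxy.2⟩) _ _ m1
    · have m2 := ψm _ (fun _ he => he.1) h'
      have h2 := Relation.ReflTransGen.lift (p := fun u v => s(u, v) ∈ S ∧
        Sum.elim φ (fun v : H.Inner => ψ v) u < Sum.elim φ (fun v : H.Inner => ψ v) v)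
        (H.glue G.s G.r) (fun x y hxy => ⟨hxy.1.2, by
          simpa [hψ'] using hxy.2⟩) _ _ m2
      rwa [Function.onFun, glue_s, glue_r] at h2

/-- The only use of series-parallelness in the protocol: one orientation serves every surviving edge
set, so crossing the network never forces a conflict. -/
theorem IsSeriesParallel.exists_hasHeight {H : Network} (h : H.IsSeriesParallel) :
    ∃ φ, H.HasHeight φ := by
  induction h with
  | k2 => exact hasHeight_K2
  | series _ _ ih ih' =>
    obtain ⟨φ, hφ⟩ := ih
    obtain ⟨ψ, hψ⟩ := ih'
    exact ⟨_, hφ.series hψ⟩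
  | parallel _ _ _ ih ih' =>
    obtain ⟨φ, hφ⟩ := ih
    obtain ⟨ψ, hψ⟩ := ih'
    exact ⟨_, hφ.parallel hψ⟩
  | @iso G H _ h ih =>
    obtain ⟨φ, φs, φr, φb, φm⟩ := ih
    obtain ⟨f, fs, fr⟩ := h
    have gs : f.symm H.s = G.s := by rw [← fs, f.symm_apply_apply]
    have gr : f.symm H.r = G.r := by rw [← fr, f.symm_apply_apply]
    refine ⟨fun v => φ (f.symm v), by simp [gs, φs], by simp [gr, φr], fun v => φb _, ?_⟩
    intro S hS h
    have h1 := h.map (f := f.symm) (T := Sym2.map f.symm '' S) fun e he => ⟨e, he, rfl⟩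
    rw [gs, gr] at h1
    have h2 := Relation.ReflTransGen.lift (p := fun u v => s(u, v) ∈ S ∧
      φ (f.symm u) < φ (f.symm v)) f (fun x y (hxy : s(x, y) ∈ Sym2.map f.symm '' S ∧ _) => ?_) _ _
      (φm _ ?_ h1)
    · rwa [Function.onFun, fs, fr] at h2
    · obtain ⟨⟨e, he, he'⟩, hlt⟩ := hxy
      have : e = s(f x, f y) := by
        rw [← Sym2.map_mk, ← he', Sym2.map_map]
        rw [show (f ∘ f.symm : H.V → H.V) = id from funext f.apply_symm_apply, Sym2.map_id, id]
      exact ⟨this ▸ he, by simpa using hlt⟩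
    · rintro _ ⟨e, he, rfl⟩
      have := hS he
      induction e with | _ x y
      exact f.symm.map_adj_iff.2 this

end Network

/-! ### Differences of reliability polynomials -/

namespace Network

/-- The polynomial `f` is the reliability of a series-parallel network, which has no edge `sr`
if `b` holds. -/
def IsReliabilityPolynomial (b : Prop) (f : Polynomial ℝ) : Prop :=
  ∃ H : Network, H.IsSeriesParallel ∧ (b → ¬ H.graph.Adj H.s H.r) ∧
    ∀ p, H.reliability (fun _ => p) = f.eval p

open Polynomial in
theorem isReliabilityPolynomial_X : IsReliabilityPolynomial False X :=
  ⟨K2, .k2, False.elim, fun p => by rw [reliability_K2, eval_X]⟩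

/-- The flag `d` is free because a series composition never has an edge sr; products may therefore
always be put in parallel. -/
theorem IsReliabilityPolynomial.mul {b c d : Prop} {f g : Polynomial ℝ}
    (hf : IsReliabilityPolynomial b f) (hg : IsReliabilityPolynomial c g) :
    IsReliabilityPolynomial d (f * g) := by
  obtain ⟨G, hG, -, hf⟩ := hf
  obtain ⟨H, hH, -, hg⟩ := hg
  exact ⟨G.series H, hG.series hH, fun _ => not_adj_series G H, fun p => by
    rw [reliability_series, hf, hg, Polynomial.eval_mul]⟩

theorem IsReliabilityPolynomial.parallel {b : Prop} {f g : Polynomial ℝ}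
    (hf : IsReliabilityPolynomial True f) (hg : IsReliabilityPolynomial b g) :
    IsReliabilityPolynomial False (f + g - f * g) := by
  obtain ⟨G, hG, hG', hf⟩ := hf
  obtain ⟨H, hH, -, hg⟩ := hg
  refine ⟨G.parallel H, hG.parallel hH fun h => hG' trivial h.1, False.elim, fun p => ?_⟩
  have := reliability_parallel G H p fun h => hG' trivial h.1
  rw [hf, hg] at this
  simp only [Polynomial.eval_sub, Polynomial.eval_add, Polynomial.eval_mul]
  linarith

open Polynomial in
theorem isReliabilityPolynomial_X_pow (n : ℕ) : IsReliabilityPolynomial False (X ^ (n + 1)) := by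
  induction n with
  | zero => simpa using isReliabilityPolynomial_X
  | succ n ih => exact pow_succ (X : ℝ[X]) (n + 1) ▸ ih.mul isReliabilityPolynomial_X

/-- The polynomial `f` is a difference of reliabilities of series-parallel networks. -/
def IsReliabilityDifference (f : Polynomial ℝ) : Prop :=
  ∃ g h, IsReliabilityPolynomial False g ∧ IsReliabilityPolynomial False h ∧ f = g - h

/-- For f = f₁-f₂ and g = g₁-g₂, put f₁g₁ parallel to f₂g₂, and f₁g₂ parallel to f₂g₁. Both parallel
compositions have the same correction term f₁f₂g₁g₂, which cancels and leaves fg. -/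
theorem IsReliabilityDifference.mul {f g : Polynomial ℝ} (hf : IsReliabilityDifference f)
    (hg : IsReliabilityDifference g) : IsReliabilityDifference (f * g) := by
  obtain ⟨f₁, f₂, h₁, h₂, rfl⟩ := hf
  obtain ⟨g₁, g₂, k₁, k₂, rfl⟩ := hg
  exact ⟨_, _, (h₁.mul (d := True) k₁).parallel (h₂.mul (d := True) k₂),
    (h₁.mul (d := True) k₂).parallel (h₂.mul (d := True) k₁), by ring⟩

theorem IsReliabilityDifference.mul_pow {f g : Polynomial ℝ} (hf : IsReliabilityDifference f)
    (hg : IsReliabilityDifference g) (n : ℕ) : IsReliabilityDifference (f * g ^ n) := by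
  induction n with
  | zero => simpa using hf
  | succ n ih => exact pow_succ g n ▸ mul_assoc f (g ^ n) g ▸ ih.mul hg

theorem IsReliabilityDifference.mul_prod_pow {ι : Type*} {f : Polynomial ℝ}
    (hf : IsReliabilityDifference f) {g : ι → Polynomial ℝ}
    (hg : ∀ i, IsReliabilityDifference (g i)) (m : ι → ℕ) (s : Finset ι) :
    IsReliabilityDifference (f * ∏ i ∈ s, g i ^ m i) := by
  classical
  induction s using Finset.induction_on with
  | empty => simpa using hf
  | insert a s ha ih =>
    rw [Finset.prod_insert ha, mul_comm (g a ^ m a), ← mul_assoc]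
    exact ih.mul_pow (hg a) (m a)

-- The starting factor for products. The constant 1 is no such difference, while p(1-p) is one and
-- has no zero in (0,1).
open Polynomial in
theorem isReliabilityDifference_X_sub : IsReliabilityDifference (X - X ^ 2) :=
  ⟨_, _, isReliabilityPolynomial_X, isReliabilityPolynomial_X_pow 1, rfl⟩

open Polynomial in
/-- The difference of the reliabilities of a path of length `n` and of two parallel paths of
length `2n`. -/
noncomputable def goldenPoly (n : ℕ) : ℝ[X] := X ^ n - 2 * X ^ (2 * n) + X ^ (4 * n)

open Polynomial in
theorem isReliabilityDifference_goldenPoly (n : ℕ) :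
    IsReliabilityDifference (goldenPoly (n + 1)) := by
  have h := (isReliabilityPolynomial_X_pow n).mul (d := True) (isReliabilityPolynomial_X_pow n)
  refine ⟨_, _, isReliabilityPolynomial_X_pow n, h.parallel h, ?_⟩
  unfold goldenPoly
  ring

theorem eval_goldenPoly (n : ℕ) (z : ℝ) : (goldenPoly n).eval z =
    z ^ n * (1 - z ^ n) * (1 - z ^ n - (z ^ n) ^ 2) := by
  simp [goldenPoly, pow_mul']
  ring

theorem inv_goldenRatio_sq : Real.goldenRatio⁻¹ ^ 2 = 1 - Real.goldenRatio⁻¹ := by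
  have h := Real.goldenRatio_sq
  have h0 := Real.goldenRatio_ne_zero
  generalize Real.goldenRatio = x at h h0
  field_simp
  linarith

theorem goldenPoly_isRoot_iff {n : ℕ} (hn : n ≠ 0) {z : ℝ} (hz : z ∈ Set.Ioo (0 : ℝ) 1) :
    (goldenPoly n).IsRoot z ↔ z ^ n = Real.goldenRatio⁻¹ := by
  have h0 : 0 < z ^ n := pow_pos hz.1 n
  have h1 : z ^ n < 1 := pow_lt_one₀ hz.1.le hz.2 hn
  have hg := Real.goldenRatio_pos
  have hg' : 0 < Real.goldenRatio⁻¹ := inv_pos.2 hg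
  have hg2 := inv_goldenRatio_sq
  rw [Polynomial.IsRoot.def, eval_goldenPoly, mul_eq_zero, or_iff_right
    (mul_pos h0 (by linarith)).ne']
  constructor
  · intro h
    -- The other root of y² + y - 1 is negative.
    have : (z ^ n - Real.goldenRatio⁻¹) * (z ^ n + Real.goldenRatio⁻¹ + 1) = 0 := by
      linear_combination -h - hg2
    rcases mul_eq_zero.1 this with h | h <;> linarith
  · intro h
    rw [h, hg2]
    ring

theorem goldenPoly_ne_zero (n : ℕ) (hn : n ≠ 0) : goldenPoly n ≠ 0 := by
  intro h
  have h1 := eval_goldenPoly n 2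
  rw [h, Polynomial.eval_zero] at h1
  have h2 : (2 : ℝ) ≤ 2 ^ n := le_self_pow₀ one_le_two hn
  have : (0 : ℝ) < 2 ^ n * (2 ^ n - 1) * (2 ^ n + (2 ^ n) ^ 2 - 1) := by
    refine mul_pos (mul_pos ?_ ?_) ?_ <;> nlinarith
  linarith

/-- With y = zⁿ = c the inverse golden ratio, z times the derivative is n(c-4c²+4c⁴). Reducing by c²
= 1-c gives nc(4c-3), which is not zero. -/
theorem rootMultiplicity_goldenPoly {n : ℕ} (hn : n ≠ 0) {z : ℝ} (hz : z ∈ Set.Ioo (0 : ℝ) 1)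
    (h : (goldenPoly n).IsRoot z) : (goldenPoly n).rootMultiplicity z = 1 := by
  refine le_antisymm ?_ ((Polynomial.rootMultiplicity_pos (goldenPoly_ne_zero n hn)).2 h)
  by_contra! hlt
  rw [Polynomial.one_lt_rootMultiplicity_iff_isRoot (goldenPoly_ne_zero n hn)] at hlt
  have hd := hlt.2
  obtain ⟨k, rfl⟩ := Nat.exists_eq_succ_of_ne_zero hn
  rw [goldenPoly_isRoot_iff hn hz] at h
  have hg := Real.goldenRatio_pos
  have hg2 := inv_goldenRatio_sq
  have hg0 : Real.goldenRatio⁻¹ ≠ 0 := inv_ne_zero hg.ne'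
  generalize Real.goldenRatio⁻¹ = c at h hg2 hg0
  have hg3 : 4 * c - 3 ≠ 0 := by
    intro h
    have : c = 3 / 4 := by linarith
    rw [this] at hg2
    norm_num at hg2
  have e' : goldenPoly (k + 1) = Polynomial.X ^ (k + 1) - 2 * (Polynomial.X ^ (k + 1)) ^ 2 +
      (Polynomial.X ^ (k + 1)) ^ 4 := by
    unfold goldenPoly
    ring
  have e : z * (Polynomial.derivative (goldenPoly (k + 1))).eval z =
      (k + 1) * (z ^ (k + 1) - 4 * (z ^ (k + 1)) ^ 2 + 4 * (z ^ (k + 1)) ^ 4) := by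
    rw [e']
    simp [Polynomial.derivative_pow]
    ring
  rw [hd.eq_zero, mul_zero, h] at e
  have : (k + 1 : ℝ) * (c * (4 * c - 3)) = 0 := by
    linear_combination -e + (k + 1 : ℝ) * (-4 * c * (c - 1)) * hg2
  have hk : (k + 1 : ℝ) ≠ 0 := by positivity
  simp [hk, hg0, hg3] at this

/-- The polynomial is (p-p²) times the product of the `goldenPoly (i + 1) ^ m i`. The i-th factor
vanishes only at the (i+1)-st root of the inverse golden ratio, and these roots increase with i. -/
theorem exists_hasProfile {t : ℕ} (m : Fin t → ℕ) (hm : ∀ i, 0 < m i) :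
    ∃ H₁ H₂ : Network, H₁.IsSeriesParallel ∧ H₂.IsSeriesParallel ∧
      HasProfile (fun p => H₁.reliability (fun _ => p) - H₂.reliability (fun _ => p)) m := by
  have hd := isReliabilityDifference_X_sub.mul_prod_pow
    (fun i : Fin t => isReliabilityDifference_goldenPoly i) m Finset.univ
  obtain ⟨f, g, ⟨H₁, h₁, -, hf⟩, ⟨H₂, h₂, -, hg⟩, hfg⟩ := hd
  set c := Real.goldenRatio⁻¹ with hc
  have hc0 : 0 < c := inv_pos.2 Real.goldenRatio_pos
  have hc1 : c < 1 := inv_lt_one_of_one_lt₀ Real.one_lt_goldenRatio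
  have hroot : ∀ n : ℕ, ∃ z ∈ Set.Ioo (0 : ℝ) 1, z ^ (n + 1) = c := by
    intro n
    have hz : (c ^ ((n + 1 : ℕ) : ℝ)⁻¹) ^ (n + 1) = c := Real.rpow_inv_natCast_pow hc0.le (by simp)
    refine ⟨_, ⟨Real.rpow_pos_of_pos hc0 _, Real.rpow_lt_one hc0.le hc1 (by positivity)⟩, hz⟩
  choose z hz hzc using hroot
  have hmono : StrictMono z := by
    intro a b hab
    refine lt_of_pow_lt_pow_left₀ (a + 1) (hz b).1.le ?_
    rw [hzc a, ← hzc b]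
    exact pow_lt_pow_right_of_lt_one₀ (hz b).1 (hz b).2 (by omega)
  have hroot : ∀ n : ℕ, ∀ w ∈ Set.Ioo (0 : ℝ) 1, (goldenPoly (n + 1)).IsRoot w ↔ w = z n := by
    intro n w hw
    rw [goldenPoly_isRoot_iff (by simp) hw, ← hc, ← hzc n]
    exact pow_left_inj₀ hw.1.le (hz n).1.le (by simp)
  have hX : ∀ w ∈ Set.Ioo (0 : ℝ) 1,
      (Polynomial.X - Polynomial.X ^ 2 : Polynomial ℝ).eval w ≠ 0 := by
    intro w hw
    have : 0 < w * (1 - w) := mul_pos hw.1 (by linarith [hw.2])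
    simp
    nlinarith
  have hX0 : (Polynomial.X - Polynomial.X ^ 2 : Polynomial ℝ) ≠ 0 := by
    intro h
    refine hX (1 / 2) (by norm_num) ?_
    rw [h, Polynomial.eval_zero]
  have hP0 : ∏ i : Fin t, goldenPoly (i + 1) ^ m i ≠ 0 :=
    Finset.prod_ne_zero_iff.2 fun i _ => pow_ne_zero _ (goldenPoly_ne_zero _ (by simp))
  refine ⟨H₁, H₂, h₁, h₂, _, mul_ne_zero hX0 hP0, fun p _ => ?_, fun i => z i,
    fun a b hab => hmono hab, ?_, ?_⟩
  · rw [hfg, Polynomial.eval_sub, ← hf, ← hg]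
  · ext w
    simp only [Set.mem_ofPred_eq, Set.mem_range]
    constructor
    · rintro ⟨hw, h⟩
      rw [Polynomial.IsRoot.def, Polynomial.eval_mul, mul_eq_zero, or_iff_right (hX w hw),
        Polynomial.eval_prod, Finset.prod_eq_zero_iff] at h
      obtain ⟨i, -, hi⟩ := h
      rw [Polynomial.eval_pow] at hi
      exact ⟨i, ((hroot i w hw).1 (eq_zero_of_pow_eq_zero hi)).symm⟩
    · rintro ⟨i, rfl⟩
      refine ⟨hz i, ?_⟩
      rw [Polynomial.IsRoot.def, Polynomial.eval_mul, mul_eq_zero, or_iff_right (hX _ (hz i)),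
        Polynomial.eval_prod, Finset.prod_eq_zero_iff]
      refine ⟨i, Finset.mem_univ _, ?_⟩
      rw [Polynomial.eval_pow, ((hroot i _ (hz i)).2 rfl).eq_zero,
        zero_pow (hm i).ne']
  · intro i
    rw [Polynomial.rootMultiplicity_mul (mul_ne_zero hX0 hP0),
      Polynomial.rootMultiplicity_eq_zero (hX _ (hz i)), zero_add, ← Polynomial.count_roots,
      Polynomial.roots_prod _ _ hP0]
    simp only [Polynomial.roots_pow, Multiset.count_bind, Multiset.count_nsmul,
      Polynomial.count_roots]
    change ∑ j : Fin t, _ = _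
    rw [Finset.sum_eq_single i, rootMultiplicity_goldenPoly (by simp) (hz i)
      ((hroot i _ (hz i)).2 rfl), mul_one]
    · intro j _ hj
      rw [Polynomial.rootMultiplicity_eq_zero, mul_zero]
      rw [hroot j _ (hz i)]
      intro h
      exact hj (Fin.ext (hmono.injective h).symm)
    · simp

end Network

/-! ### Breakpoints of piecewise polynomial functions -/

section Breakpoints

open Polynomial Set Filter Topology

theorem timesDifferentiableAt_of_eventuallyEq_eval (k : ℕ) {f : ℝ → ℝ} {z : ℝ} {P : ℝ[X]}
    (h : ∀ᶠ y in 𝓝 z, f y = P.eval y) : TimesDifferentiableAt k f z := by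
  induction k generalizing f P with
  | zero => exact P.continuous.continuousAt.congr (h.mono fun _ h => h.symm)
  | succ k ih =>
    have hd : ∀ᶠ y in 𝓝 z, HasDerivAt f (P.derivative.eval y) y :=
      h.eventually_nhds.mono fun y hy => (P.hasDerivAt y).congr_of_eventuallyEq hy
    cases k with
    | zero => exact hd.self_of_nhds.differentiableAt
    | succ k => exact ⟨hd.mono fun y hy => hy.differentiableAt, ih (hd.mono fun y hy => hy.deriv)⟩

/-- Induction by differentiation: if the multiplicity exceeds 1, the one-sided derivatives agree at
`z`, and the derivative of `f` is glued from the derivatives of `A` and `C`, whose difference has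
multiplicity one less. At multiplicity 1 the one-sided derivatives differ. -/
theorem timesDifferentiableAt_of_rootMultiplicity (n : ℕ) {f : ℝ → ℝ} {z : ℝ} {A C : ℝ[X]}
    (hA : ∀ᶠ y in 𝓝 z, y ≤ z → f y = A.eval y) (hC : ∀ᶠ y in 𝓝 z, z ≤ y → f y = C.eval y)
    (h0 : C - A ≠ 0) (hm : (C - A).rootMultiplicity z = n + 1) :
    TimesDifferentiableAt n f z ∧ ¬ TimesDifferentiableAt (n + 1) f z := by
  have hroot : (C - A).IsRoot z := (rootMultiplicity_pos h0).1 (by omega)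
  have hz : C.eval z = A.eval z := by
    have := hroot.eq_zero
    rw [eval_sub] at this
    linarith
  have hA' : f =ᶠ[𝓝[≤] z] A.eval := by
    filter_upwards [nhdsWithin_le_nhds hA, self_mem_nhdsWithin] with y h h' using h h'
  have hC' : f =ᶠ[𝓝[≥] z] C.eval := by
    filter_upwards [nhdsWithin_le_nhds hC, self_mem_nhdsWithin] with y h h' using h h'
  have fA : f z = A.eval z := hA.self_of_nhds le_rfl
  have fC : f z = C.eval z := hC.self_of_nhds le_rfl
  have dA : HasDerivWithinAt f (A.derivative.eval z) (Iic z) z :=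
    (A.hasDerivWithinAt z _).congr_of_eventuallyEq hA' fA
  have dC : HasDerivWithinAt f (C.derivative.eval z) (Ici z) z :=
    (C.hasDerivWithinAt z _).congr_of_eventuallyEq hC' fC
  induction n generalizing f A C with
  | zero =>
    constructor
    · exact continuousAt_iff_continuous_left_right.2
        ⟨dA.continuousWithinAt, dC.continuousWithinAt⟩
    · intro hd
      change DifferentiableAt ℝ f z at hd
      have e1 := (uniqueDiffOn_Iic z z self_mem_Iic).eq_deriv _ dA hd.hasDerivAt.hasDerivWithinAt
      have e2 := (uniqueDiffOn_Ici z z self_mem_Ici).eq_deriv _ dC hd.hasDerivAt.hasDerivWithinAt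
      have : 1 < (C - A).rootMultiplicity z := by
        rw [one_lt_rootMultiplicity_iff_isRoot h0]
        refine ⟨hroot, ?_⟩
        rw [derivative_sub, IsRoot.def, eval_sub, e1, e2, sub_self]
      omega
  | succ n ih =>
    have hmd : (derivative (C - A)).rootMultiplicity z = n + 1 := by
      rw [derivative_rootMultiplicity_of_root hroot, hm]
      rfl
    have h0d : derivative (C - A) ≠ 0 := by
      intro h
      rw [h, rootMultiplicity_zero] at hmd
      omega
    have hrootd : (derivative (C - A)).IsRoot z := (rootMultiplicity_pos h0d).1 (by omega)
    have hzd : C.derivative.eval z = A.derivative.eval z := by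
      have := hrootd.eq_zero
      rw [derivative_sub, eval_sub] at this
      linarith
    rw [derivative_sub] at hmd h0d hrootd
    have dz : HasDerivAt f (A.derivative.eval z) z := by
      have := dA.union (hzd ▸ dC)
      rwa [Iic_union_Ici, hasDerivWithinAt_univ] at this
    have dl : ∀ᶠ y in 𝓝 z, y ≤ z → HasDerivAt f (A.derivative.eval y) y := by
      filter_upwards [hA.eventually_nhds] with y hy hle
      rcases hle.eq_or_lt with rfl | hlt
      · exact dz
      · refine (A.hasDerivAt y).congr_of_eventuallyEq ?_
        filter_upwards [hy, Iio_mem_nhds hlt] with w h h' using h h'.le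
    have dr : ∀ᶠ y in 𝓝 z, z ≤ y → HasDerivAt f (C.derivative.eval y) y := by
      filter_upwards [hC.eventually_nhds] with y hy hle
      rcases hle.eq_or_lt with rfl | hlt
      · exact hzd ▸ dz
      · refine (C.hasDerivAt y).congr_of_eventuallyEq ?_
        filter_upwards [hy, Ioi_mem_nhds hlt] with w h h' using h h'.le
    have dd : ∀ᶠ y in 𝓝 z, DifferentiableAt ℝ f y := by
      filter_upwards [dl, dr] with y h h'
      rcases le_total y z with hy | hy
      · exact (h hy).differentiableAt
      · exact (h' hy).differentiableAt
    have el : ∀ᶠ y in 𝓝 z, y ≤ z → deriv f y = A.derivative.eval y :=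
      dl.mono fun y h hy => (h hy).deriv
    have er : ∀ᶠ y in 𝓝 z, z ≤ y → deriv f y = C.derivative.eval y :=
      dr.mono fun y h hy => (h hy).deriv
    have el' : deriv f =ᶠ[𝓝[≤] z] A.derivative.eval := by
      filter_upwards [nhdsWithin_le_nhds el, self_mem_nhdsWithin] with y h h' using h h'
    have er' : deriv f =ᶠ[𝓝[≥] z] C.derivative.eval := by
      filter_upwards [nhdsWithin_le_nhds er, self_mem_nhdsWithin] with y h h' using h h'
    have := ih el er h0d hmd hrootd hzd el' er' dz.deriv (dz.deriv.trans hzd.symm)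
      ((A.derivative.hasDerivWithinAt z _).congr_of_eventuallyEq el' dz.deriv)
      ((C.derivative.hasDerivWithinAt z _).congr_of_eventuallyEq er' (dz.deriv.trans hzd.symm))
    refine ⟨?_, fun h => this.2 h.2⟩
    cases n with
    | zero => exact dz.differentiableAt
    | succ n => exact ⟨dd, this.1⟩

variable {f : ℝ → ℝ} {R a b : ℝ[X]} {t : ℕ} {x : Fin t → ℝ}

/-- Near `z`, a - b is (p-z)ᵐ times a factor `u` of constant sign. As m is odd, the smaller of the
two polynomials changes at `z`; the sign of `u` decides which one applies on the left. -/
theorem isBreakpointOfOrder_sub_min {z : ℝ} (hz : z ∈ Ioo (0 : ℝ) 1)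
    (hf : ∀ p ∈ Ioo (0 : ℝ) 1, f p = R.eval p - min (a.eval p) (b.eval p)) (hab : a - b ≠ 0)
    {m : ℕ} (hm : (a - b).rootMultiplicity z = m) (hodd : Odd m) : IsBreakpointOfOrder f m z := by
  obtain ⟨n, rfl⟩ : ∃ n, m = n + 1 := Nat.exists_eq_add_one.2 hodd.pos
  refine ⟨hz, by omega, ?_⟩
  rw [Nat.add_sub_cancel]
  obtain ⟨u, hu⟩ := (a - b).pow_rootMultiplicity_dvd z
  have hu0 : u.eval z ≠ 0 := by
    intro h0
    obtain ⟨v, hv⟩ := dvd_iff_isRoot.2 h0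
    refine (a - b).pow_rootMultiplicity_not_dvd hab z ⟨v, ?_⟩
    rw [pow_succ, mul_assoc, ← hv, ← hu]
  rw [hm] at hu
  have hab' : ∀ p, a.eval p - b.eval p = (p - z) ^ (n + 1) * u.eval p := by
    intro p
    rw [← eval_sub, hu]
    simp
  have hnear : ∀ᶠ y in 𝓝 z, y ∈ Ioo (0 : ℝ) 1 := Ioo_mem_nhds hz.1 hz.2
  rcases hu0.lt_or_gt with hneg | hpos
  · have hs := u.continuous.continuousAt.eventually_lt continuousAt_const hneg
    refine timesDifferentiableAt_of_rootMultiplicity n (A := R - b) (C := R - a) ?_ ?_ ?_ ?_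
    · filter_upwards [hs, hnear] with y h hy hle
      have := mul_nonneg_of_nonpos_of_nonpos (hodd.pow_nonpos (sub_nonpos.2 hle)) h.le
      rw [← hab' y] at this
      rw [hf y hy, eval_sub, min_eq_right (by linarith)]
    · filter_upwards [hs, hnear] with y h hy hle
      have := mul_nonpos_of_nonneg_of_nonpos (pow_nonneg (sub_nonneg.2 hle) (n + 1)) h.le
      rw [← hab' y] at this
      rw [hf y hy, eval_sub, min_eq_left (by linarith)]
    · rw [show R - a - (R - b) = -(a - b) by ring]
      exact neg_ne_zero.2 hab
    · rw [show R - a - (R - b) = C (-1) * (a - b) by simp,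
        rootMultiplicity_mul (mul_ne_zero (by simp) hab), rootMultiplicity_C, zero_add, hm]
  · have hs := continuousAt_const.eventually_lt u.continuous.continuousAt hpos
    refine timesDifferentiableAt_of_rootMultiplicity n (A := R - a) (C := R - b) ?_ ?_ ?_ ?_
    · filter_upwards [hs, hnear] with y h hy hle
      have := mul_nonpos_of_nonpos_of_nonneg (hodd.pow_nonpos (sub_nonpos.2 hle)) h.le
      rw [← hab' y] at this
      rw [hf y hy, eval_sub, min_eq_left (by linarith)]
    · filter_upwards [hs, hnear] with y h hy hle
      have := mul_nonneg (pow_nonneg (sub_nonneg.2 hle) (n + 1)) h.le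
      rw [← hab' y] at this
      rw [hf y hy, eval_sub, min_eq_right (by linarith)]
    · rwa [show R - b - (R - a) = a - b by ring]
    · rwa [show R - b - (R - a) = a - b by ring]

theorem not_isBreakpoint_sub_min {z : ℝ} (hz : z ∈ Ioo (0 : ℝ) 1)
    (hf : ∀ p ∈ Ioo (0 : ℝ) 1, f p = R.eval p - min (a.eval p) (b.eval p))
    (hab : ¬ (a - b).IsRoot z) : ¬ IsBreakpoint f z := by
  rintro ⟨m, -, -, -, h⟩
  have hnear : ∀ᶠ y in 𝓝 z, y ∈ Ioo (0 : ℝ) 1 := Ioo_mem_nhds hz.1 hz.2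
  have hne : a.eval z ≠ b.eval z := by
    intro h
    exact hab (by rw [IsRoot.def, eval_sub, h, sub_self])
  rcases hne.lt_or_gt with hlt | hlt
  · refine h (timesDifferentiableAt_of_eventuallyEq_eval m (P := R - a) ?_)
    filter_upwards [hnear, a.continuous.continuousAt.eventually_lt b.continuous.continuousAt hlt]
      with y hy h
    rw [hf y hy, min_eq_left h.le, eval_sub]
  · refine h (timesDifferentiableAt_of_eventuallyEq_eval m (P := R - b) ?_)
    filter_upwards [hnear, b.continuous.continuousAt.eventually_lt a.continuous.continuousAt hlt]
      with y hy h
    rw [hf y hy, min_eq_right h.le, eval_sub]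

/-- Between consecutive zeros a - b has constant sign by the intermediate value theorem, and by
continuity the weak inequality extends to the closed interval. -/
theorem isPiecewisePolynomial_sub_min
    (hf : ∀ p ∈ Ioo (0 : ℝ) 1, f p = R.eval p - min (a.eval p) (b.eval p))
    (hx : StrictMono x) (hr : {z ∈ Ioo (0 : ℝ) 1 | (a - b).IsRoot z} = range x) :
    IsPiecewisePolynomial f := by
  have hx01 : ∀ i, x i ∈ Ioo (0 : ℝ) 1 := fun i => (hr.superset ⟨i, rfl⟩).1
  -- The nodes are 0, the zeros in order, and 1.
  let c : Fin (t + 2) → ℝ := fun k =>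
    if k.val = 0 then 0 else if h : k.val - 1 < t then x ⟨k.val - 1, h⟩ else 1
  have hcx : ∀ j : Fin t, c ⟨j.val + 1, by omega⟩ = x j := by
    intro j
    simp [c]
  have hc : StrictMono c := by
    rw [Fin.strictMono_iff_lt_succ]
    intro i
    simp only [c, Fin.val_castSucc, Fin.val_succ, Nat.add_sub_cancel, Nat.succ_ne_zero, if_false]
    have hi := i.2
    split_ifs with h1 h2 h3 h4
    · exact (hx01 _).1
    · exact one_pos
    · exact hx (Fin.mk_lt_mk.2 (by omega))
    · exact (hx01 _).2
    · omega
    · omega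
  have hex : ∀ i : Fin (t + 1), ∃ q : ℝ[X], ∀ p ∈ Icc (c i.castSucc) (c i.succ) ∩ Ioo (0 : ℝ) 1,
      f p = q.eval p := by
    intro i
    have hlt : c i.castSucc < c i.succ := hc i.castSucc_lt_succ
    have h0 : ∀ k, 0 ≤ c k := fun k => by
      have : c 0 = 0 := by simp [c]
      exact this ▸ hc.monotone (Fin.zero_le k)
    have h1 : ∀ k, c k ≤ 1 := fun k => by
      have : c (Fin.last _) = 1 := by simp [c]
      exact this ▸ hc.monotone (Fin.le_last k)
    have hno : ∀ p ∈ Ioo (c i.castSucc) (c i.succ), (a - b).eval p ≠ 0 := by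
      intro p hp h
      obtain ⟨j, rfl⟩ := hr.subset
        (⟨⟨(h0 _).trans_lt hp.1, hp.2.trans_le (h1 _)⟩, h⟩ : p ∈ {z ∈ Ioo (0 : ℝ) 1 | _})
      rw [← hcx j, mem_Ioo, hc.lt_iff_lt, hc.lt_iff_lt, Fin.lt_def, Fin.lt_def] at hp
      simp at hp
      omega
    have hsign : (∀ p ∈ Ioo (c i.castSucc) (c i.succ), 0 ≤ (a - b).eval p) ∨
        ∀ p ∈ Ioo (c i.castSucc) (c i.succ), (a - b).eval p ≤ 0 := by
      by_contra! h
      obtain ⟨⟨p, hp, hp'⟩, ⟨r, hr, hr'⟩⟩ := h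
      obtain ⟨w, hw, hw'⟩ := isPreconnected_Ioo.intermediate_value hp hr
        (a - b).continuous.continuousOn ⟨hp'.le, hr'.le⟩
      exact hno w hw hw'
    rcases hsign with h | h
    · refine ⟨R - b, fun p hp => ?_⟩
      have : 0 ≤ (a - b).eval p :=
        closure_minimal (t := {p | 0 ≤ (a - b).eval p}) h
          (isClosed_le continuous_const (a - b).continuous)
          (by rw [closure_Ioo hlt.ne]; exact hp.1)
      rw [eval_sub] at this
      rw [hf p hp.2, min_eq_right (by linarith), eval_sub]
    · refine ⟨R - a, fun p hp => ?_⟩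
      have : (a - b).eval p ≤ 0 :=
        closure_minimal (t := {p | (a - b).eval p ≤ 0}) h
          (isClosed_le (a - b).continuous continuous_const)
          (by rw [closure_Ioo hlt.ne]; exact hp.1)
      rw [eval_sub] at this
      rw [hf p hp.2, min_eq_left (by linarith), eval_sub]
  choose q hq using hex
  exact ⟨t, c, q, hc, by simp [c], by simp [c], hq⟩

end Breakpoints

/-! ### Continuing walks of a protocol -/

namespace Network

/-- There is a walk in `S` of length greater than `n` to the receiver that starts with `uv`
and contains only instructions from `A`. -/
def Protocol.Continues {G : Network} (A : G.Protocol) (S : Set (Sym2 G.V)) (n : ℕ) (u v : G.V) :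
    Prop :=
  ∃ (h : G.graph.Adj u v) (W : G.graph.Walk v G.r), n ≤ W.length ∧
    (∀ e ∈ (SimpleGraph.Walk.cons h W).edges, e ∈ S) ∧
    ∀ i, i + 2 ≤ (SimpleGraph.Walk.cons h W).length →
      ((SimpleGraph.Walk.cons h W).getVert i, (SimpleGraph.Walk.cons h W).getVert (i + 1),
        (SimpleGraph.Walk.cons h W).getVert (i + 2)) ∈ A.instr

section

variable {G : Network} {A : G.Protocol} {S : Set (Sym2 G.V)} {u v w : G.V} {n : ℕ}

theorem Protocol.Continues.nil (h : G.graph.Adj u G.r) (hS : s(u, G.r) ∈ S) :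
    A.Continues S 0 u G.r :=
  ⟨h, .nil, le_rfl, by simpa using hS, by simp⟩

theorem Protocol.Continues.cons (hA : (u, v, w) ∈ A.instr) (hS : s(u, v) ∈ S)
    (h : A.Continues S n v w) : A.Continues S (n + 1) u v := by
  obtain ⟨hvw, W, hn, hWS, hWA⟩ := h
  refine ⟨(A.valid u v w hA).1, .cons hvw W, by simpa using hn, ?_, ?_⟩
  · intro e he
    rw [SimpleGraph.Walk.edges_cons, List.mem_cons] at he
    rcases he with rfl | he
    · exact hS
    · exact hWS e he
  · rintro (_ | i) hi
    · simpa using hA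
    · simp only [SimpleGraph.Walk.getVert_cons_succ]
      exact hWA i (by simpa using hi)

theorem Protocol.Continues.mono {k : ℕ} (h : A.Continues S n u v) (hk : k ≤ n) :
    A.Continues S k u v := by
  obtain ⟨huv, W, hn, hW⟩ := h
  exact ⟨huv, W, hk.trans hn, hW⟩

theorem Protocol.Continues.exists_isWalk (h : A.Continues S n G.s v) :
    ∃ W : G.graph.Walk G.s G.r, A.IsWalk W ∧ (∀ e ∈ W.edges, e ∈ S) ∧ n ≤ W.length := by
  obtain ⟨huv, W, hn, hWS, hWA⟩ := h
  exact ⟨.cons huv W, hWA, hWS, hn.trans (by simp)⟩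

theorem Protocol.not_isFinite_of_continues (h : ∀ n, ∃ v, A.Continues S n G.s v) :
    ¬ A.IsFinite := by
  intro hfin
  obtain ⟨N, hN⟩ := (hfin.image fun W => W.length).bddAbove
  obtain ⟨v, hv⟩ := h (N + 1)
  obtain ⟨W, hW, -, hlen⟩ := hv.exists_isWalk
  have := hN ⟨W, hW, rfl⟩
  dsimp only at this
  omega

/-- Protocols have no memory beyond the last directed edge, so a segment of one walk can be followed
by any continuation of its final directed edge. This is what allows walks to be spliced. -/
theorem Protocol.IsWalk.continues_of_le {W : G.graph.Walk G.s G.r} (hW : A.IsWalk W) {i j : ℕ}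
    (hij : i ≤ j) (hj : j + 1 ≤ W.length)
    (h : A.Continues Set.univ n (W.getVert j) (W.getVert (j + 1))) :
    A.Continues Set.univ (n + (j - i)) (W.getVert i) (W.getVert (i + 1)) := by
  induction j, hij using Nat.le_induction generalizing n with
  | base => simpa using h
  | succ j hij ih =>
    have := ih (by omega) (h.cons (hW j hj) (Set.mem_univ _))
    exact this.mono (by omega)

theorem Protocol.IsWalk.continues {W : G.graph.Walk G.s G.r} (hW : A.IsWalk W) {i : ℕ}
    (hi : i + 1 ≤ W.length) :
    A.Continues Set.univ 0 (W.getVert i) (W.getVert (i + 1)) := by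
  obtain ⟨L, hL⟩ : ∃ L, W.length = L + 1 := Nat.exists_eq_add_one.2 (by omega)
  have hadj := W.adj_getVert_succ (i := L) (by omega)
  have hr : W.getVert (L + 1) = G.r := by rw [← hL, W.getVert_length]
  refine (hW.continues_of_le (n := 0) (i := i) (j := L) (by omega) (by omega) ?_).mono
    (Nat.zero_le _)
  rw [hr] at hadj ⊢
  exact .nil hadj (Set.mem_univ _)

/-- The protocol of all instructions `uvw` such that `vw` has a higher rank than `uv`. -/
def rankProtocol (G : Network) (ρ : G.V × G.V → ℝ) : G.Protocol where
  instr := {x | G.graph.Adj x.1 x.2.1 ∧ G.graph.Adj x.2.1 x.2.2 ∧ x.1 ≠ x.2.2 ∧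
    ρ (x.1, x.2.1) < ρ (x.2.1, x.2.2)}
  valid _ _ _ h := ⟨h.1, h.2.1, h.2.2.1⟩

theorem finite_setOf_walk_length_le (G : Network) (N : ℕ) :
    {W : G.graph.Walk G.s G.r | W.length ≤ N}.Finite := by
  refine Set.Finite.of_finite_image (f := fun W => W.support)
    ((List.finite_length_le G.V (N + 1)).subset ?_) ?_
  · rintro _ ⟨W, hW, rfl⟩
    have : W.length ≤ N := hW
    simpa using this
  · intro W _ W' _ h
    exact SimpleGraph.Walk.ext_support h

/-- Ranks increase along a walk, so no directed edge occurs twice and lengths are bounded. -/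
theorem isFinite_rankProtocol (G : Network) (ρ : G.V × G.V → ℝ) : (G.rankProtocol ρ).IsFinite := by
  refine (G.finite_setOf_walk_length_le (Nat.card (G.V × G.V))).subset fun W hW => ?_
  have hstep : ∀ i, i + 2 ≤ W.length → ρ (W.getVert i, W.getVert (i + 1)) <
      ρ (W.getVert (i + 1), W.getVert (i + 2)) := fun i hi => (hW i hi).2.2.2
  have hlt : ∀ i j, i < j → j < W.length → ρ (W.getVert i, W.getVert (i + 1)) <
      ρ (W.getVert j, W.getVert (j + 1)) := by
    intro i j hij
    induction j, hij using Nat.le_induction with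
    | base => exact fun h => hstep i h
    | succ j hij ih => exact fun h => (ih (by omega)).trans (hstep j h)
  have hinj : Function.Injective
      fun i : Fin W.length => (W.getVert i, W.getVert (i + 1)) := by
    intro i j hij
    by_contra hne
    have hij' : ρ (W.getVert i, W.getVert (i + 1)) = ρ (W.getVert j, W.getVert (j + 1)) :=
      congrArg ρ hij
    rcases lt_or_gt_of_ne hne with h | h
    · exact (hlt i j h j.2).ne hij'
    · exact (hlt j i h i.2).ne' hij'
  have := Nat.card_le_card_of_injective _ hinj
  simpa using this

end

/-! ### Expansions of the graph `B₀` -/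

/-- The edges of `B₀` other than `s1` and `s2`. -/
def coreEdges : Finset (Sym2 (Fin 7)) :=
  {s(1, 3), s(1, 4), s(2, 3), s(2, 5), s(3, 4), s(3, 5), s(4, 6), s(5, 6)}

/-- The edges of the path `1,4,3,2,5,r` of `B₀`. -/
def lostEdges : Finset (Sym2 (Fin 7)) :=
  {s(1, 4), s(3, 4), s(2, 3), s(2, 5), s(5, 6)}

/-- The automorphism of `B₀` that exchanges `1`, `2` and `4`, `5`. -/
def b0Mirror : Equiv.Perm (Fin 7) := Equiv.swap 1 2 * Equiv.swap 4 5

/-- The network `G` is the expansion of `B₀` by `H₁` at `s1` and `H₂` at `s2`; the maps are the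
embeddings of the vertices. -/
structure IsB0Expansion (H₁ H₂ G : Network) (g₀ : Fin 7 → G.V) (g₁ : H₁.V → G.V)
    (g₂ : H₂.V → G.V) : Prop where
  inj₀ : g₀.Injective
  inj₁ : g₁.Injective
  inj₂ : g₂.Injective
  eq₀₁ : ∀ x v, g₀ x = g₁ v ↔ x = 0 ∧ v = H₁.s ∨ x = 1 ∧ v = H₁.r
  eq₀₂ : ∀ x v, g₀ x = g₂ v ↔ x = 0 ∧ v = H₂.s ∨ x = 2 ∧ v = H₂.r
  eq₁₂ : ∀ v w, g₁ v = g₂ w ↔ v = H₁.s ∧ w = H₂.s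
  sender : g₀ 0 = G.s
  receiver : g₀ 6 = G.r
  edgeSet_eq : G.graph.edgeSet = Sym2.map g₀ '' coreEdges ∪
    (Sym2.map g₁ '' H₁.graph.edgeSet ∪ Sym2.map g₂ '' H₂.graph.edgeSet)

theorem image_b0Mirror_coreEdges : coreEdges.image (Sym2.map b0Mirror) = coreEdges := by
  decide

theorem isB0Expansion_expandB0 (H₁ H₂ : Network) :
    IsB0Expansion H₁ H₂ (expandB0 H₁ H₂) (fun x => Sum.inl (Sum.inl x))
      (fun v => Sum.inl (H₁.glue (0 : Fin 7) 1 v))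
      (H₂.glue (Sum.inl (0 : Fin 7)) (Sum.inl 2)) where
  inj₀ := Sum.inl_injective.comp Sum.inl_injective
  inj₁ := Sum.inl_injective.comp (H₁.glue_injective (by decide))
  inj₂ := H₂.glue_injective (by simp)
  eq₀₁ x v := by
    rw [Sum.inl_injective.eq_iff]
    exact glue_eq_inl_iff _ _
  eq₀₂ x v := by
    refine (glue_eq_inl_iff _ _).trans ?_
    rw [Sum.inl_injective.eq_iff, Sum.inl_injective.eq_iff]
  eq₁₂ v w := by
    refine (glue_eq_inl_iff _ _).trans ?_
    rw [eq_comm, glue_eq_inl_iff, eq_comm (b := Sum.inl 2), glue_eq_inl_iff]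
    have := H₁.s_ne_r
    simp
  sender := rfl
  receiver := rfl
  edgeSet_eq := by
    have h1 : (expandB0 H₁ H₂).graph.edgeSet = Sym2.map Sum.inl ''
        ((Sym2.map Sum.inl '' (B0.graph.edgeSet \ {s((0 : Fin 7), (1 : Fin 7))}) ∪
          Sym2.map (H₁.glue (0 : Fin 7) 1) '' H₁.graph.edgeSet) \ {s(Sum.inl 0, Sum.inl 2)}) ∪
        Sym2.map (H₂.glue (Sum.inl (0 : Fin 7)) (Sum.inl 2)) '' H₂.graph.edgeSet := by
      rw [← edgeSet_map_of_injective (H₂.glue_injective (by simp)),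
        ← edgeSet_map_of_injective (H₁.glue_injective (by decide)),
        ← SimpleGraph.edgeSet_deleteEdges, ← edgeSet_map_of_injective Sum.inl_injective,
        ← SimpleGraph.edgeSet_sup, ← SimpleGraph.edgeSet_deleteEdges,
        ← edgeSet_map_of_injective Sum.inl_injective, ← SimpleGraph.edgeSet_sup]
    have h2 : ∀ e : Sym2 (Fin 7), e ∈ coreEdges ↔
        e ∈ B0.graph.edgeSet \ {s((0 : Fin 7), (1 : Fin 7))} ∧ e ≠ s(0, 2) := by
      intro e
      simp only [SimpleGraph.edgeSet_fromEdgeSet, Set.mem_sdiff, Set.mem_insert_iff,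
        Set.mem_singleton_iff, Sym2.mem_diagSet]
      revert e
      decide
    rw [h1, ← Set.union_assoc]
    congr 1
    ext e
    constructor
    · rintro ⟨e, ⟨⟨e, he, rfl⟩ | ⟨e, he, rfl⟩, hne⟩, rfl⟩
      · refine Or.inl ⟨e, (h2 e).2 ⟨he, ?_⟩, (Sym2.map_map ..).symm⟩
        rintro rfl
        exact hne rfl
      · exact Or.inr ⟨e, he, (Sym2.map_map ..).symm⟩
    · rintro (⟨e, he, rfl⟩ | ⟨e, he, rfl⟩)
      · obtain ⟨he, hne⟩ := (h2 e).1 he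
        refine ⟨Sym2.map Sum.inl e, ⟨Or.inl ⟨e, he, rfl⟩, ?_⟩, Sym2.map_map ..⟩
        intro h
        exact hne (Sym2.map.injective Sum.inl_injective (h.trans (by simp)))
      · refine ⟨Sym2.map (H₁.glue (0 : Fin 7) 1) e, ⟨Or.inr ⟨e, he, rfl⟩, ?_⟩, Sym2.map_map ..⟩
        intro h
        have h3 : Sum.inl 2 ∈ Sym2.map (H₁.glue (0 : Fin 7) 1) e := by
          rw [h]
          exact Sym2.mem_mk_right _ _
        obtain ⟨v, -, hv⟩ := Sym2.mem_map.1 h3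
        have := (glue_eq_inl_iff _ _).1 hv.symm
        simp at this

/-- Every statement about the first route thereby also holds for its mirror image. -/
theorem IsB0Expansion.swap {H₁ H₂ G : Network} {g₀ : Fin 7 → G.V} {g₁ : H₁.V → G.V}
    {g₂ : H₂.V → G.V} (h : IsB0Expansion H₁ H₂ G g₀ g₁ g₂) :
    IsB0Expansion H₂ H₁ G (g₀ ∘ b0Mirror) g₂ g₁ where
  inj₀ := h.inj₀.comp b0Mirror.injective
  inj₁ := h.inj₂
  inj₂ := h.inj₁
  eq₀₁ x v := by
    have hx : ∀ x, (b0Mirror x = 0 ↔ x = 0) ∧ (b0Mirror x = 2 ↔ x = 1) := by decide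
    rw [Function.comp_apply, h.eq₀₂, (hx x).1, (hx x).2]
  eq₀₂ x v := by
    have hx : ∀ x, (b0Mirror x = 0 ↔ x = 0) ∧ (b0Mirror x = 1 ↔ x = 2) := by decide
    rw [Function.comp_apply, h.eq₀₁, (hx x).1, (hx x).2]
  eq₁₂ v w := by
    rw [eq_comm, h.eq₁₂, and_comm]
  sender := h.sender
  receiver := h.receiver
  edgeSet_eq := by
    rw [h.edgeSet_eq, Set.union_comm (Sym2.map g₁ '' _)]
    congr 1
    conv_rhs =>
      rw [Sym2.map_comp, Set.image_comp, ← Finset.coe_image, image_b0Mirror_coreEdges]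

end Network

/-! ### Traces of surviving sets on the pieces -/

section Pullback

variable {α β γ : Type*}

open Classical in
/-- The elements of `E` that `f` maps into `S`. -/
noncomputable def pullback (E : Finset α) (f : α → γ) (S : Finset γ) : Finset α :=
  E.filter fun e => f e ∈ S

theorem mem_pullback {E : Finset α} {f : α → γ} {S : Finset γ} {e : α} :
    e ∈ pullback E f S ↔ e ∈ E ∧ f e ∈ S := by
  simp [pullback]

theorem bernoulliProb_mul_pullback [DecidableEq γ] {E₁ : Finset α} {E₂ : Finset β} {E : Finset γ}
    {f₁ : α → γ} {f₂ : β → γ} (h₁ : f₁.Injective) (h₂ : f₂.Injective)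
    (hE : E = E₁.image f₁ ∪ E₂.image f₂) (hd : ∀ a ∈ E₁, ∀ b ∈ E₂, f₁ a ≠ f₂ b)
    (p : ℝ) (Q₁ : Finset α → Prop) (Q₂ : Finset β → Prop) :
    bernoulliProb E p (fun S => Q₁ (pullback E₁ f₁ S) ∧ Q₂ (pullback E₂ f₂ S)) =
      bernoulliProb E₁ p Q₁ * bernoulliProb E₂ p Q₂ := by
  refine bernoulliProb_mul h₁ h₂ hE hd fun S₁ hS₁ S₂ hS₂ => ?_
  have e₁ : pullback E₁ f₁ (S₁.image f₁ ∪ S₂.image f₂) = S₁ := by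
    ext e
    simp only [mem_pullback, Finset.mem_union, Finset.mem_image]
    constructor
    · rintro ⟨he, ⟨a, ha, h⟩ | ⟨b, hb, h⟩⟩
      · exact h₁ h ▸ ha
      · exact absurd h.symm (hd e he b (hS₂ hb))
    · exact fun he => ⟨hS₁ he, Or.inl ⟨e, he, rfl⟩⟩
  have e₂ : pullback E₂ f₂ (S₁.image f₁ ∪ S₂.image f₂) = S₂ := by
    ext e
    simp only [mem_pullback, Finset.mem_union, Finset.mem_image]
    constructor
    · rintro ⟨he, ⟨a, ha, h⟩ | ⟨b, hb, h⟩⟩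
      · exact absurd h (hd a (hS₁ ha) e he)
      · exact h₂ h ▸ hb
    · exact fun he => ⟨hS₂ he, Or.inr ⟨e, he, rfl⟩⟩
  rw [e₁, e₂]

end Pullback

/-! ### The lost event and the upper bound for finite protocols -/

namespace Network

/-- Exactly the edges of the path `1,4,3,2,5,r` of `B₀` survive, together with edges that connect
`s` and `1`, but no edges that connect `s` and `2`. -/
def LostEvent {H₁ H₂ G : Network} (g₀ : Fin 7 → G.V) (g₁ : H₁.V → G.V) (g₂ : H₂.V → G.V)
    (S : Finset (Sym2 G.V)) : Prop :=
  pullback coreEdges (Sym2.map g₀) S = lostEdges ∧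
    EdgeConn (pullback H₁.edges (Sym2.map g₁) S : Set (Sym2 H₁.V)) H₁.s H₁.r ∧
    ¬ EdgeConn (pullback H₂.edges (Sym2.map g₂) S : Set (Sym2 H₂.V)) H₂.s H₂.r

namespace IsB0Expansion

variable {H₁ H₂ G : Network} {g₀ : Fin 7 → G.V} {g₁ : H₁.V → G.V} {g₂ : H₂.V → G.V}

theorem map_core_ne (h : IsB0Expansion H₁ H₂ G g₀ g₁ g₂) {e : Sym2 (Fin 7)} (he : e ∈ coreEdges)
    (f : Sym2 H₁.V) : Sym2.map g₀ e ≠ Sym2.map g₁ f := by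
  induction e with | _ x y
  induction f with | _ u v
  intro hef
  have hxy : ∀ x y, s(x, y) ∈ coreEdges → ¬ ((x = 0 ∨ x = 1) ∧ (y = 0 ∨ y = 1)) := by decide
  rw [Sym2.map_mk, Sym2.map_mk, Sym2.eq_iff, h.eq₀₁, h.eq₀₁, h.eq₀₁, h.eq₀₁] at hef
  exact hxy x y he (by tauto)

theorem map₁_ne (h : IsB0Expansion H₁ H₂ G g₀ g₁ g₂) {e : Sym2 H₁.V} (he : e ∈ H₁.edges)
    (f : Sym2 H₂.V) : Sym2.map g₁ e ≠ Sym2.map g₂ f := by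
  induction e with | _ x y
  induction f with | _ u v
  intro hef
  have hne : x ≠ y := SimpleGraph.Adj.ne ((mem_edges _ _).1 he)
  rw [Sym2.map_mk, Sym2.map_mk, Sym2.eq_iff, h.eq₁₂, h.eq₁₂, h.eq₁₂, h.eq₁₂] at hef
  rcases hef with ⟨h1, h2⟩ | ⟨h1, h2⟩ <;> exact hne (h1.1.trans h2.1.symm)

theorem mem_edges_iff (h : IsB0Expansion H₁ H₂ G g₀ g₁ g₂) (e : Sym2 G.V) :
    e ∈ G.edges ↔ (∃ a ∈ coreEdges, Sym2.map g₀ a = e) ∨ (∃ a ∈ H₁.edges, Sym2.map g₁ a = e) ∨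
      ∃ a ∈ H₂.edges, Sym2.map g₂ a = e := by
  rw [mem_edges, h.edgeSet_eq]
  simp [mem_edges]

/-- The core, H₁ and H₂ have disjoint edge sets, so the three conditions are independent; in the
core, five prescribed edges survive and three fail. -/
theorem bernoulliProb_lostEvent (h : IsB0Expansion H₁ H₂ G g₀ g₁ g₂) (p : ℝ) :
    bernoulliProb G.edges p (LostEvent g₀ g₁ g₂) = p ^ 5 * (1 - p) ^ 3 *
      (H₁.reliability (fun _ => p) * (1 - H₂.reliability (fun _ => p))) := by
  classical
  rw [reliability_eq, reliability_eq, ← bernoulliProb_not,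
    ← bernoulliProb_mul_pullback (Sym2.map.injective h.inj₁) (Sym2.map.injective h.inj₂) rfl
      fun a ha b _ => h.map₁_ne ha b,
    show p ^ 5 * (1 - p) ^ 3 = p ^ lostEdges.card * (1 - p) ^ (coreEdges.card - lostEdges.card)
      from rfl, ← bernoulliProb_eq coreEdges lostEdges (by decide),
    ← bernoulliProb_mul_pullback (E := G.edges) (Sym2.map.injective h.inj₀)
      Function.injective_id]
  · refine bernoulliProb_congr fun S _ => and_congr Iff.rfl ?_
    have e₁ : ∀ T, pullback H₁.edges (Sym2.map g₁) (pullback (H₁.edges.image (Sym2.map g₁) ∪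
        H₂.edges.image (Sym2.map g₂)) id T) = pullback H₁.edges (Sym2.map g₁) T := by
      intro T
      ext e
      simp only [mem_pullback, Finset.mem_union, Finset.mem_image, id]
      exact ⟨fun h => ⟨h.1, h.2.2⟩, fun h => ⟨h.1, Or.inl ⟨e, h.1, rfl⟩, h.2⟩⟩
    have e₂ : ∀ T, pullback H₂.edges (Sym2.map g₂) (pullback (H₁.edges.image (Sym2.map g₁) ∪
        H₂.edges.image (Sym2.map g₂)) id T) = pullback H₂.edges (Sym2.map g₂) T := by
      intro T
      ext e
      simp only [mem_pullback, Finset.mem_union, Finset.mem_image, id]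
      exact ⟨fun h => ⟨h.1, h.2.2⟩, fun h => ⟨h.1, Or.inr ⟨e, h.1, rfl⟩, h.2⟩⟩
    rw [e₁, e₂]
  · ext e
    rw [h.mem_edges_iff]
    simp
  · intro a ha b hb hab
    simp only [Finset.mem_union, Finset.mem_image, id] at hb hab
    rcases hb with ⟨f, hf, rfl⟩ | ⟨f, hf, rfl⟩
    · exact h.map_core_ne ha f hab
    · refine h.swap.map_core_ne (e := Sym2.map b0Mirror a) ?_ f ?_
      · rw [← image_b0Mirror_coreEdges]
        exact Finset.mem_image_of_mem _ ha
      · rw [Sym2.map_map, ← hab, Function.comp_assoc,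
          show (b0Mirror : Fin 7 → Fin 7) ∘ b0Mirror = id by decide, Function.comp_id]

theorem edgeConn_of_pullback₁ {S : Finset (Sym2 G.V)} {u v : H₁.V}
    (h : EdgeConn (pullback H₁.edges (Sym2.map g₁) S : Set (Sym2 H₁.V)) u v) :
    EdgeConn (S : Set (Sym2 G.V)) (g₁ u) (g₁ v) :=
  h.map fun _ he => (mem_pullback.1 (Finset.mem_coe.1 he)).2

theorem edgeConn_of_lostEvent (h : IsB0Expansion H₁ H₂ G g₀ g₁ g₂) {S : Finset (Sym2 G.V)}
    (hS : LostEvent g₀ g₁ g₂ S) : EdgeConn (S : Set (Sym2 G.V)) G.s G.r := by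
  obtain ⟨h0, h1, -⟩ := hS
  have hstep : ∀ x y, s(x, y) ∈ lostEdges → s(g₀ x, g₀ y) ∈ (S : Set (Sym2 G.V)) := by
    intro x y hxy
    rw [← h0, mem_pullback] at hxy
    exact hxy.2
  have h2 := edgeConn_of_pullback₁ h1
  rw [← (h.eq₀₁ 0 H₁.s).2 (Or.inl ⟨rfl, rfl⟩), ← (h.eq₀₁ 1 H₁.r).2 (Or.inr ⟨rfl, rfl⟩),
    h.sender] at h2
  rw [← h.receiver]
  exact ((((h2.tail (hstep 1 4 (by decide))).tail (hstep 4 3 (by decide))).tail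
    (hstep 3 2 (by decide))).tail (hstep 2 5 (by decide))).tail (hstep 5 6 (by decide))

/-- The end vertices of a surviving edge. -/
theorem adj_cases (h : IsB0Expansion H₁ H₂ G g₀ g₁ g₂) {S : Finset (Sym2 G.V)} (hS : S ⊆ G.edges)
    {u v : G.V} (huv : s(u, v) ∈ S) :
    (∃ x y, u = g₀ x ∧ v = g₀ y ∧ s(x, y) ∈ pullback coreEdges (Sym2.map g₀) S) ∨
    (∃ x y, u = g₁ x ∧ v = g₁ y ∧ s(x, y) ∈ pullback H₁.edges (Sym2.map g₁) S) ∨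
    ∃ x y, u = g₂ x ∧ v = g₂ y ∧ s(x, y) ∈ pullback H₂.edges (Sym2.map g₂) S := by
  have key : ∀ {V : Type} (g : V → G.V) (E : Finset (Sym2 V)),
      (∃ a ∈ E, Sym2.map g a = s(u, v)) →
      ∃ x y, u = g x ∧ v = g y ∧ s(x, y) ∈ pullback E (Sym2.map g) S := by
    rintro V g E ⟨e, he, hev⟩
    induction e with | _ x y
    have hmem : s(x, y) ∈ pullback E (Sym2.map g) S := mem_pullback.2 ⟨he, hev ▸ huv⟩
    rw [Sym2.map_mk, Sym2.eq_iff] at hev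
    rcases hev with ⟨rfl, rfl⟩ | ⟨rfl, rfl⟩
    · exact ⟨x, y, rfl, rfl, hmem⟩
    · exact ⟨y, x, rfl, rfl, Sym2.eq_swap ▸ hmem⟩
  rcases (h.mem_edges_iff _).1 (hS huv) with h' | h' | h'
  · exact Or.inl (key g₀ _ h')
  · exact Or.inr (Or.inl (key g₁ _ h'))
  · exact Or.inr (Or.inr (key g₂ _ h'))

/-- The only surviving exit from the side of the sender is 1 to 4, and since walks cannot reverse,
every walk ends with 2,5,r. The walk inside H₁ is irrelevant. -/
theorem exists_darts_of_lostEvent (h : IsB0Expansion H₁ H₂ G g₀ g₁ g₂) {S : Finset (Sym2 G.V)}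
    (hS : S ⊆ G.edges) (hL : LostEvent g₀ g₁ g₂ S) {A : G.Protocol} {W : G.graph.Walk G.s G.r}
    (hW : A.IsWalk W) (hWS : ∀ e ∈ W.edges, e ∈ S) :
    ∃ i j, i < j ∧ j + 1 ≤ W.length ∧ W.getVert i = g₀ 1 ∧ W.getVert (i + 1) = g₀ 4 ∧
      W.getVert j = g₀ 2 ∧ W.getVert (j + 1) = g₀ 5 := by
  obtain ⟨h0, -, h2⟩ := hL
  have hedge : ∀ i < W.length, s(W.getVert i, W.getVert (i + 1)) ∈ S := by
    intro i hi
    exact hWS _ (W.mk_mem_edges_iff_exists.2 ⟨i, hi, rfl⟩)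
  -- The side of the sender: all of H₁, and the part of H₂ that is connected to s inside H₂, which
  -- does not contain 2.
  let P : G.V → Prop := fun v => (∃ a, v = g₁ a) ∨ ∃ b, v = g₂ b ∧
    EdgeConn (pullback H₂.edges (Sym2.map g₂) S : Set (Sym2 H₂.V)) H₂.s b
  have hP₀ : ∀ x, P (g₀ x) → x = 0 ∨ x = 1 := by
    rintro x (⟨a, ha⟩ | ⟨b, hb, hb'⟩)
    · rw [h.eq₀₁] at ha
      tauto
    · rw [h.eq₀₂] at hb
      rcases hb with ⟨rfl, -⟩ | ⟨-, rfl⟩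
      · exact Or.inl rfl
      · exact absurd hb' h2
  have hcross : ∀ u v, s(u, v) ∈ S → P u → ¬ P v → u = g₀ 1 ∧ v = g₀ 4 := by
    intro u v huv hu hv
    rcases h.adj_cases hS huv with ⟨x, y, rfl, rfl, hxy⟩ | ⟨x, y, rfl, rfl, -⟩ |
      ⟨x, y, rfl, rfl, hxy⟩
    · have hd : ∀ x y, s(x, y) ∈ lostEdges → x = 0 ∨ x = 1 → x = 1 ∧ y = 4 := by decide
      obtain ⟨rfl, rfl⟩ := hd x y (h0 ▸ hxy) (hP₀ x hu)
      exact ⟨rfl, rfl⟩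
    · exact absurd (Or.inl ⟨y, rfl⟩) hv
    · refine absurd (Or.inr ⟨y, rfl, ?_⟩) hv
      rcases hu with ⟨a, ha⟩ | ⟨b, hb, hb'⟩
      · obtain ⟨-, rfl⟩ := (h.eq₁₂ _ _).1 ha.symm
        exact .single hxy
      · exact (h.inj₂ hb ▸ hb').tail hxy
  have hs : P (W.getVert 0) := by
    rw [W.getVert_zero, ← h.sender]
    exact Or.inl ⟨H₁.s, (h.eq₀₁ _ _).2 (Or.inl ⟨rfl, rfl⟩)⟩
  have hr : ¬ P (W.getVert W.length) := by
    rw [W.getVert_length, ← h.receiver]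
    intro hP
    exact absurd (hP₀ 6 hP) (by decide)
  obtain ⟨i, hi, hi₁, hi₂⟩ : ∃ i < W.length, P (W.getVert i) ∧ ¬ P (W.getVert (i + 1)) := by
    by_contra! hn
    have : ∀ i ≤ W.length, P (W.getVert i) := by
      intro i
      induction i with
      | zero => exact fun _ => hs
      | succ i ih => exact fun hle => hn i hle (ih (by omega))
    exact hr (this _ le_rfl)
  obtain ⟨hi₁, hi₂⟩ := hcross _ _ (hedge i hi) hi₁ hi₂
  have hto6 : ∀ u, s(u, g₀ 6) ∈ S → u = g₀ 5 := by
    intro u hu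
    rcases h.adj_cases hS hu with ⟨x, y, rfl, hy, hxy⟩ | ⟨x, y, rfl, hy, -⟩ | ⟨x, y, rfl, hy, -⟩
    · obtain rfl := h.inj₀ hy
      have hd : ∀ x, s(x, 6) ∈ lostEdges → x = 5 := by decide
      rw [hd x (h0 ▸ hxy)]
    · simp [h.eq₀₁] at hy
    · simp [h.eq₀₂] at hy
  have hto5 : ∀ u, s(u, g₀ 5) ∈ S → u = g₀ 2 ∨ u = g₀ 6 := by
    intro u hu
    rcases h.adj_cases hS hu with ⟨x, y, rfl, hy, hxy⟩ | ⟨x, y, rfl, hy, -⟩ | ⟨x, y, rfl, hy, -⟩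
    · obtain rfl := h.inj₀ hy
      have hd : ∀ x, s(x, 5) ∈ lostEdges → x = 2 ∨ x = 6 := by decide
      rcases hd x (h0 ▸ hxy) with rfl | rfl
      · exact Or.inl rfl
      · exact Or.inr rfl
    · simp [h.eq₀₁] at hy
    · simp [h.eq₀₂] at hy
  have hlast : W.getVert W.length = g₀ 6 := by rw [W.getVert_length, h.receiver]
  have hi46 : W.length ≠ i + 1 := by
    intro hl
    rw [hl, hi₂] at hlast
    exact absurd (h.inj₀ hlast) (by decide)
  obtain ⟨L, hL⟩ : ∃ L, W.length = L + 2 := ⟨W.length - 2, by omega⟩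
  rw [hL] at hlast
  have h5 : W.getVert (L + 1) = g₀ 5 := by
    have := hedge (L + 1) (by omega)
    rw [hlast] at this
    exact hto6 _ this
  have h2 : W.getVert L = g₀ 2 := by
    have := hedge L (by omega)
    rw [h5] at this
    -- Arriving at 5 from r would make r,5,r an instruction.
    refine (hto5 _ this).resolve_right fun h6 => ?_
    have := hW L (by omega)
    exact (A.valid _ _ _ this).2.2 (h6.trans hlast.symm)
  refine ⟨i, L, ?_, by omega, hi₁, hi₂, h2, h5⟩
  have n1 : i ≠ L := by
    rintro rfl
    rw [hi₁] at h2
    exact absurd (h.inj₀ h2) (by decide)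
  have n2 : i ≠ L + 1 := by
    rintro rfl
    rw [hi₁] at h5
    exact absurd (h.inj₀ h5) (by decide)
  omega

/-- `W` leads from 14 to 25 and `W'` from 25 to 14, so the two segments can be alternated
arbitrarily often before the receiver is approached. -/
theorem not_isFinite (h : IsB0Expansion H₁ H₂ G g₀ g₁ g₂) {A : G.Protocol}
    {S S' : Finset (Sym2 G.V)} (hS : S ⊆ G.edges) (hS' : S' ⊆ G.edges)
    (hL : LostEvent g₀ g₁ g₂ S) (hL' : LostEvent (g₀ ∘ b0Mirror) g₂ g₁ S')
    {W W' : G.graph.Walk G.s G.r} (hW : A.IsWalk W) (hWS : ∀ e ∈ W.edges, e ∈ S)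
    (hW' : A.IsWalk W') (hWS' : ∀ e ∈ W'.edges, e ∈ S') : ¬ A.IsFinite := by
  obtain ⟨i, j, hij, hj, i1, i4, j2, j5⟩ := h.exists_darts_of_lostEvent hS hL hW hWS
  obtain ⟨i', j', hij', hj', i2, i5, j1, j4⟩ :=
    h.swap.exists_darts_of_lostEvent hS' hL' hW' hWS'
  replace i2 : W'.getVert i' = g₀ 2 := i2
  replace i5 : W'.getVert (i' + 1) = g₀ 5 := i5
  replace j1 : W'.getVert j' = g₀ 1 := j1
  replace j4 : W'.getVert (j' + 1) = g₀ 4 := j4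
  have key : ∀ n, A.Continues Set.univ n (g₀ 1) (g₀ 4) := by
    intro n
    induction n with
    | zero => exact i1 ▸ i4 ▸ hW.continues (by omega)
    | succ n ih =>
      rw [← j1, ← j4] at ih
      have h1 := hW'.continues_of_le hij'.le hj' ih
      rw [i2, i5, ← j2, ← j5] at h1
      have h2 := hW.continues_of_le hij.le hj h1
      rw [i1, i4] at h2
      exact h2.mono (by omega)
  refine Protocol.not_isFinite_of_continues (S := Set.univ) fun n => ⟨W.getVert 1, ?_⟩
  have h1 := key n
  rw [← i1, ← i4] at h1
  have h2 := hW.continues_of_le (Nat.zero_le i) (by omega) h1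
  rw [W.getVert_zero] at h2
  exact h2.mono (by omega)

end IsB0Expansion

theorem edgeConn_of_walk {G : Network} {S : Set (Sym2 G.V)} {u v : G.V} (W : G.graph.Walk u v)
    (hW : ∀ e ∈ W.edges, e ∈ S) : EdgeConn S u v := by
  induction W with
  | nil => exact .refl
  | cons _ _ ih =>
    exact .head (hW _ (by simp)) (ih fun e he => hW e (by simp [he]))

/-- A protocol without walks in the event `Q` loses at least the probability of `Q`. -/
theorem protocolReliability_le {G : Network} {p : ℝ} (h0 : 0 ≤ p) (h1 : p ≤ 1) {A : G.Protocol}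
    {Q : Finset (Sym2 G.V) → Prop} (hQ : ∀ S, Q S → EdgeConn (S : Set (Sym2 G.V)) G.s G.r)
    (hA : ∀ S ⊆ G.edges, Q S → ¬ ∃ W, A.IsWalk W ∧ ∀ e ∈ W.edges, e ∈ S) :
    G.protocolReliability (fun _ => p) A ≤
      G.reliability (fun _ => p) - bernoulliProb G.edges p Q := by
  rw [protocolReliability_eq, reliability_eq]
  have h4 := bernoulliProb_add_and_not G.edges p
    (fun S => EdgeConn (S : Set (Sym2 G.V)) G.s G.r) Q
  have h2 := bernoulliProb_mono (E := G.edges) h0 h1 (Q := Q)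
    (Q' := fun S => EdgeConn (S : Set (Sym2 G.V)) G.s G.r ∧ Q S) fun S _ h => ⟨hQ S h, h⟩
  have h3 := bernoulliProb_mono (E := G.edges) h0 h1
    (Q := fun S => ∃ W : G.graph.Walk G.s G.r, A.IsWalk W ∧ ∀ e ∈ W.edges, e ∈ S)
    (Q' := fun S => EdgeConn (S : Set (Sym2 G.V)) G.s G.r ∧ ¬ Q S)
    fun S hS h => ⟨edgeConn_of_walk _ h.choose_spec.2, fun hq => hA S hS hq h⟩
  linarith

/-- A protocol with walks in all connected events outside `Q` loses at most the probability
of `Q`. -/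
theorem le_protocolReliability {G : Network} {p : ℝ} (h0 : 0 ≤ p) (h1 : p ≤ 1) {A : G.Protocol}
    {Q : Finset (Sym2 G.V) → Prop}
    (hA : ∀ S ⊆ G.edges, EdgeConn (S : Set (Sym2 G.V)) G.s G.r → ¬ Q S →
      ∃ W, A.IsWalk W ∧ ∀ e ∈ W.edges, e ∈ S) :
    G.reliability (fun _ => p) - bernoulliProb G.edges p Q ≤
      G.protocolReliability (fun _ => p) A := by
  rw [protocolReliability_eq, reliability_eq]
  have h4 := bernoulliProb_add_and_not G.edges p
    (fun S => EdgeConn (S : Set (Sym2 G.V)) G.s G.r) Q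
  have h2 := bernoulliProb_mono (E := G.edges) h0 h1 (Q' := Q)
    (Q := fun S => EdgeConn (S : Set (Sym2 G.V)) G.s G.r ∧ Q S) fun S _ h => h.2
  have h3 := bernoulliProb_mono (E := G.edges) h0 h1
    (Q' := fun S => ∃ W : G.graph.Walk G.s G.r, A.IsWalk W ∧ ∀ e ∈ W.edges, e ∈ S)
    (Q := fun S => EdgeConn (S : Set (Sym2 G.V)) G.s G.r ∧ ¬ Q S)
    fun S hS h => hA S hS h.1 h.2
  linarith

end Network

/-! ### An ascending protocol that loses only one event -/

namespace Network

/-- The list contains every sr-path of `B₀` except 1,4,3,2,5,r. If that path survives outside the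
lost event, then 13, 35, 46 or s2 is available as well, and each of them opens a listed route. -/
theorem exists_b0_cut (c₁ c₂ a₁₃ a₁₄ a₂₃ a₂₅ a₃₄ a₃₅ a₄₆ a₅₆ : Bool)
    (h : ¬ ((c₁ && a₁₄ && a₄₆) || (c₁ && a₁₃ && a₃₄ && a₄₆) || (c₁ && a₁₃ && a₃₅ && a₅₆) ||
      (c₁ && a₁₄ && a₃₄ && a₃₅ && a₅₆) || (c₁ && a₁₃ && a₂₃ && a₂₅ && a₅₆) ||
      (c₂ && a₂₅ && a₅₆) || (c₂ && a₂₃ && a₃₅ && a₅₆) || (c₂ && a₂₃ && a₃₄ && a₄₆) ||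
      (c₂ && a₂₅ && a₃₅ && a₃₄ && a₄₆) || (c₂ && a₂₃ && a₁₃ && a₁₄ && a₄₆) ||
      (c₂ && a₂₅ && a₃₅ && a₁₃ && a₁₄ && a₄₆)))
    (h' : ¬ (c₁ && !c₂ && !a₁₃ && a₁₄ && a₂₃ && a₂₅ && a₃₄ && !a₃₅ && !a₄₆ && a₅₆)) :
    ∃ R : Fin 7 → Bool, R 0 ∧ ¬ R 6 ∧ (c₁ → R 1) ∧ (c₂ → R 2) ∧ (a₁₃ → R 1 = R 3) ∧
      (a₁₄ → R 1 = R 4) ∧ (a₂₃ → R 2 = R 3) ∧ (a₂₅ → R 2 = R 5) ∧ (a₃₄ → R 3 = R 4) ∧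
      (a₃₅ → R 3 = R 5) ∧ (a₄₆ → R 4 = R 6) ∧ (a₅₆ → R 5 = R 6) := by
  -- The set of vertices reachable from s without passing through r.
  refine ⟨![true,
    c₁ || (c₂ && ((a₂₃ && (a₁₃ || (a₃₄ && a₁₄))) || (a₂₅ && a₃₅ && (a₁₃ || (a₃₄ && a₁₄))))),
    c₂ || (c₁ && ((a₁₃ && (a₂₃ || (a₃₅ && a₂₅))) || (a₁₄ && a₃₄ && (a₂₃ || (a₃₅ && a₂₅))))),
    (c₁ && (a₁₃ || (a₁₄ && a₃₄))) || (c₂ && (a₂₃ || (a₂₅ && a₃₅))),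
    (c₁ && (a₁₄ || (a₁₃ && a₃₄))) ||
      (c₂ && (a₂₃ || (a₂₅ && a₃₅)) && (a₃₄ || (a₁₃ && a₁₄))),
    (c₂ && (a₂₅ || (a₂₃ && a₃₅))) ||
      (c₁ && (a₁₃ || (a₁₄ && a₃₄)) && (a₃₅ || (a₂₃ && a₂₅))), false], ?_⟩
  change true = true ∧ ¬ false = true ∧ (_ → _ = true) ∧ _
  revert c₁ c₂ a₁₃ a₁₄ a₂₃ a₂₅ a₃₄ a₃₅ a₄₆ a₅₆
  decide

/-- An order in which the directed edges of `B₀` may be used. -/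
def dartRank : Fin 7 → Fin 7 → ℕ :=
  ![![0, 0, 0, 0, 0, 0, 0], ![0, 0, 0, 2, 7, 0, 0], ![0, 0, 0, 2, 0, 4, 0],
    ![0, 6, 3, 0, 9, 9, 0], ![0, 0, 0, 8, 0, 0, 10], ![0, 0, 0, 5, 0, 0, 10],
    ![0, 0, 0, 0, 0, 0, 0]]

namespace IsB0Expansion

variable {H₁ H₂ G : Network} {g₀ : Fin 7 → G.V} {g₁ : H₁.V → G.V} {g₂ : H₂.V → G.V}

theorem edgeConn_imp (h : IsB0Expansion H₁ H₂ G g₀ g₁ g₂) {S : Finset (Sym2 G.V)}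
    (hS : S ⊆ G.edges) (hconn : EdgeConn (S : Set (Sym2 G.V)) G.s G.r) {R : Fin 7 → Prop}
    (h0 : R 0)
    (h1 : EdgeConn (pullback H₁.edges (Sym2.map g₁) S : Set (Sym2 H₁.V)) H₁.s H₁.r → R 1)
    (h2 : EdgeConn (pullback H₂.edges (Sym2.map g₂) S : Set (Sym2 H₂.V)) H₂.s H₂.r → R 2)
    (hR : ∀ x y, s(x, y) ∈ pullback coreEdges (Sym2.map g₀) S → R x → R y) : R 6 := by
  -- The cut of `B₀` is lifted to the expansion. H₁ may also be entered backwards from the vertex 1,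
  -- hence the second alternative.
  let U₁ : H₁.V → Prop := fun v =>
    EdgeConn (pullback H₁.edges (Sym2.map g₁) S : Set (Sym2 H₁.V)) H₁.s v ∨
    R 1 ∧ EdgeConn (pullback H₁.edges (Sym2.map g₁) S : Set (Sym2 H₁.V)) H₁.r v
  let U₂ : H₂.V → Prop := fun v =>
    EdgeConn (pullback H₂.edges (Sym2.map g₂) S : Set (Sym2 H₂.V)) H₂.s v ∨
    R 2 ∧ EdgeConn (pullback H₂.edges (Sym2.map g₂) S : Set (Sym2 H₂.V)) H₂.r v
  have hr₁ : U₁ H₁.r → R 1 := fun h => h.elim h1 And.left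
  have hr₂ : U₂ H₂.r → R 2 := fun h => h.elim h2 And.left
  have key : (∀ x, G.r = g₀ x → R x) ∧ (∀ v, G.r = g₁ v → U₁ v) ∧ ∀ v, G.r = g₂ v → U₂ v := by
    refine hconn.invariant (P := fun u => (∀ x, u = g₀ x → R x) ∧ (∀ v, u = g₁ v → U₁ v) ∧
      ∀ v, u = g₂ v → U₂ v) ?_ ?_
    · rw [← h.sender]
      refine ⟨fun x hx => h.inj₀ hx ▸ h0, fun v hv => ?_, fun v hv => ?_⟩
      · rcases (h.eq₀₁ _ _).1 hv with ⟨-, rfl⟩ | ⟨h, -⟩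
        · exact Or.inl .refl
        · exact absurd h (by decide)
      · rcases (h.eq₀₂ _ _).1 hv with ⟨-, rfl⟩ | ⟨h, -⟩
        · exact Or.inl .refl
        · exact absurd h (by decide)
    · rintro u v huv ⟨hu₀, hu₁, hu₂⟩
      rcases h.adj_cases hS huv with ⟨x, y, rfl, rfl, hxy⟩ | ⟨x, y, rfl, rfl, hxy⟩ |
        ⟨x, y, rfl, rfl, hxy⟩
      · have hy : R y := hR x y hxy (hu₀ x rfl)
        refine ⟨fun z hz => h.inj₀ hz ▸ hy, fun v hv => ?_, fun v hv => ?_⟩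
        · rcases (h.eq₀₁ _ _).1 hv with ⟨-, rfl⟩ | ⟨rfl, rfl⟩
          · exact Or.inl .refl
          · exact Or.inr ⟨hy, .refl⟩
        · rcases (h.eq₀₂ _ _).1 hv with ⟨-, rfl⟩ | ⟨rfl, rfl⟩
          · exact Or.inl .refl
          · exact Or.inr ⟨hy, .refl⟩
      · have hy : U₁ y := (hu₁ x rfl).imp (fun h => h.tail hxy) fun h => ⟨h.1, h.2.tail hxy⟩
        refine ⟨fun z hz => ?_, fun v hv => h.inj₁ hv ▸ hy, fun v hv => ?_⟩
        · rcases (h.eq₀₁ _ _).1 hz.symm with ⟨rfl, -⟩ | ⟨rfl, rfl⟩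
          · exact h0
          · exact hr₁ hy
        · obtain ⟨-, rfl⟩ := (h.eq₁₂ _ _).1 hv
          exact Or.inl .refl
      · have hy : U₂ y := (hu₂ x rfl).imp (fun h => h.tail hxy) fun h => ⟨h.1, h.2.tail hxy⟩
        refine ⟨fun z hz => ?_, fun v hv => ?_, fun v hv => h.inj₂ hv ▸ hy⟩
        · rcases (h.eq₀₂ _ _).1 hz.symm with ⟨rfl, -⟩ | ⟨rfl, rfl⟩
          · exact h0
          · exact hr₂ hy
        · obtain ⟨rfl, -⟩ := (h.eq₁₂ _ _).1 hv.symm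
          exact Or.inl .refl
  exact key.1 6 h.receiver.symm

theorem exists_route (h : IsB0Expansion H₁ H₂ G g₀ g₁ g₂) {S : Finset (Sym2 G.V)}
    (hS : S ⊆ G.edges) (hconn : EdgeConn (S : Set (Sym2 G.V)) G.s G.r)
    (hL : ¬ LostEvent g₀ g₁ g₂ S) {c₁ c₂ : Prop}
    (hc₁ : EdgeConn (pullback H₁.edges (Sym2.map g₁) S : Set (Sym2 H₁.V)) H₁.s H₁.r ↔ c₁)
    (hc₂ : EdgeConn (pullback H₂.edges (Sym2.map g₂) S : Set (Sym2 H₂.V)) H₂.s H₂.r ↔ c₂)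
    {T : Finset (Sym2 (Fin 7))} (hT : pullback coreEdges (Sym2.map g₀) S = T) :
    (c₁ ∧ s(1, 4) ∈ T ∧ s(4, 6) ∈ T) ∨
    (c₁ ∧ s(1, 3) ∈ T ∧ s(3, 4) ∈ T ∧ s(4, 6) ∈ T) ∨
    (c₁ ∧ s(1, 3) ∈ T ∧ s(3, 5) ∈ T ∧ s(5, 6) ∈ T) ∨
    (c₁ ∧ s(1, 4) ∈ T ∧ s(3, 4) ∈ T ∧ s(3, 5) ∈ T ∧ s(5, 6) ∈ T) ∨
    (c₁ ∧ s(1, 3) ∈ T ∧ s(2, 3) ∈ T ∧ s(2, 5) ∈ T ∧ s(5, 6) ∈ T) ∨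
    (c₂ ∧ s(2, 5) ∈ T ∧ s(5, 6) ∈ T) ∨
    (c₂ ∧ s(2, 3) ∈ T ∧ s(3, 5) ∈ T ∧ s(5, 6) ∈ T) ∨
    (c₂ ∧ s(2, 3) ∈ T ∧ s(3, 4) ∈ T ∧ s(4, 6) ∈ T) ∨
    (c₂ ∧ s(2, 5) ∈ T ∧ s(3, 5) ∈ T ∧ s(3, 4) ∈ T ∧ s(4, 6) ∈ T) ∨
    (c₂ ∧ s(2, 3) ∈ T ∧ s(1, 3) ∈ T ∧ s(1, 4) ∈ T ∧ s(4, 6) ∈ T) ∨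
    (c₂ ∧ s(2, 5) ∈ T ∧ s(3, 5) ∈ T ∧ s(1, 3) ∈ T ∧ s(1, 4) ∈ T ∧ s(4, 6) ∈ T) := by
  classical
  by_contra hn
  have hTc : ∀ e ∈ T, e ∈ coreEdges := fun e he => (mem_pullback.1 (hT ▸ he)).1
  obtain ⟨R, h0, h6, h1, h2, r13, r14, r23, r25, r34, r35, r46, r56⟩ :=
    exists_b0_cut (decide c₁) (decide c₂) (decide (s(1, 3) ∈ T)) (decide (s(1, 4) ∈ T))
      (decide (s(2, 3) ∈ T)) (decide (s(2, 5) ∈ T)) (decide (s(3, 4) ∈ T))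
      (decide (s(3, 5) ∈ T)) (decide (s(4, 6) ∈ T)) (decide (s(5, 6) ∈ T))
      (by simpa only [Bool.or_eq_true, Bool.and_eq_true, decide_eq_true_eq, and_assoc,
            or_assoc] using hn) (by
        intro hF
        simp only [Bool.and_eq_true, Bool.not_eq_true', decide_eq_true_eq,
          decide_eq_false_iff_not] at hF
        refine hL ⟨?_, hc₁.2 (by tauto), fun hc => ?_⟩
        · rw [hT]
          ext e
          constructor
          · intro he
            have := hTc e he
            simp only [coreEdges, Finset.mem_insert, Finset.mem_singleton] at this
            rcases this with rfl | rfl | rfl | rfl | rfl | rfl | rfl | rfl <;>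
              first | decide | tauto
          · intro he
            simp only [lostEdges, Finset.mem_insert, Finset.mem_singleton] at he
            rcases he with rfl | rfl | rfl | rfl | rfl <;> tauto
        · have := hc₂.1 hc
          tauto)
  refine h6 (h.edgeConn_imp hS hconn (R := fun x => R x) h0 (fun hc => h1 (by simpa using hc₁.1 hc))
    (fun hc => h2 (by simpa using hc₂.1 hc)) ?_)
  rw [hT]
  intro x y hxy
  simp only [decide_eq_true_eq] at r13 r14 r23 r25 r34 r35 r46 r56
  have hR : R x = R y := by
    have := hTc _ hxy
    simp only [coreEdges, Finset.mem_insert, Finset.mem_singleton, Sym2.eq_iff] at this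
    rcases this with h | h | h | h | h | h | h | h <;> rcases h with ⟨rfl, rfl⟩ | ⟨rfl, rfl⟩ <;>
      first
        | exact r13 hxy | exact r14 hxy | exact r23 hxy | exact r25 hxy
        | exact r34 hxy | exact r35 hxy | exact r46 hxy | exact r56 hxy
        | (rw [Sym2.eq_swap] at hxy
           first
            | exact (r13 hxy).symm | exact (r14 hxy).symm | exact (r23 hxy).symm
            | exact (r25 hxy).symm | exact (r34 hxy).symm | exact (r35 hxy).symm
            | exact (r46 hxy).symm | exact (r56 hxy).symm)
  exact fun hx => hR ▸ hx

theorem exists_rank (h : IsB0Expansion H₁ H₂ G g₀ g₁ g₂) (φ₁ : H₁.V → ℝ) (φ₂ : H₂.V → ℝ) :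
    ∃ ρ : G.V × G.V → ℝ, (∀ x y, H₁.graph.Adj x y → ρ (g₁ x, g₁ y) = φ₁ x) ∧
      (∀ x y, H₂.graph.Adj x y → ρ (g₂ x, g₂ y) = φ₂ x) ∧
      ∀ x y, s(x, y) ∈ coreEdges → ρ (g₀ x, g₀ y) = dartRank x y := by
  -- A directed edge inside H₁ or H₂ is ranked by the height of its tail. The three definitions do
  -- not interfere, since no edge lies in two pieces.
  refine ⟨Function.extend (Prod.map g₁ g₁) (fun d => φ₁ d.1) (Function.extend (Prod.map g₂ g₂)
    (fun d => φ₂ d.1) (Function.extend (Prod.map g₀ g₀) (fun d => (dartRank d.1 d.2 : ℝ)) 0)),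
    fun x y _ => ?_, fun x y hxy => ?_, fun x y hxy => ?_⟩
  · exact (h.inj₁.prodMap h.inj₁).extend_apply _ _ (x, y)
  · rw [Function.extend_apply']
    · exact (h.inj₂.prodMap h.inj₂).extend_apply _ _ (x, y)
    · rintro ⟨⟨u, v⟩, huv⟩
      rw [Prod.map_apply, Prod.mk.injEq, h.eq₁₂, h.eq₁₂] at huv
      exact hxy.ne (huv.1.2.trans huv.2.2.symm)
  · rw [Function.extend_apply', Function.extend_apply']
    · exact (h.inj₀.prodMap h.inj₀).extend_apply _ _ (x, y)
    · rintro ⟨⟨u, v⟩, huv⟩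
      have hd : ∀ x y, s(x, y) ∈ coreEdges → (x = 0 ∨ x = 2) → (y = 0 ∨ y = 2) → False := by
        decide
      rw [Prod.map_apply, Prod.mk.injEq, eq_comm, h.eq₀₂, eq_comm, eq_comm (a := g₂ v),
        h.eq₀₂] at huv
      exact hd x y hxy (by tauto) (by tauto)
    · rintro ⟨⟨u, v⟩, huv⟩
      refine h.map_core_ne hxy s(u, v) ?_
      rw [Prod.map_apply, Prod.mk.injEq] at huv
      rw [Sym2.map_mk, Sym2.map_mk, huv.1, huv.2]

end IsB0Expansion

/-- A walk that leaves an embedded network of bounded height at its receiver can be prolonged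
backwards to the sender. -/
theorem exists_continues_sender {G H : Network} {g : H.V → G.V}
    (hadj : ∀ x y, H.graph.Adj x y → G.graph.Adj (g x) (g y)) {φ : H.V → ℝ} (hφ : H.HasHeight φ)
    (hg : g.Injective) {ρ : G.V × G.V → ℝ} (hρ : ∀ x y, H.graph.Adj x y → ρ (g x, g y) = φ x)
    {S : Finset (Sym2 G.V)}
    (hconn : EdgeConn (pullback H.edges (Sym2.map g) S : Set (Sym2 H.V)) H.s H.r) {v : G.V}
    (hv : ∀ x, g x ≠ v) (hρv : 1 < ρ (g H.r, v)) {n : ℕ}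
    (hc : (G.rankProtocol ρ).Continues S n (g H.r) v) :
    ∃ n w, (G.rankProtocol ρ).Continues S n (g H.s) w := by
  have hpath := hφ.2.2.2 _ (fun e he => (mem_edges _ _).1 (mem_pullback.1 (Finset.mem_coe.1 he)).1)
    hconn
  have hstep : ∀ x y, s(x, y) ∈ (pullback H.edges (Sym2.map g) S : Set (Sym2 H.V)) →
      H.graph.Adj x y ∧ s(g x, g y) ∈ (S : Set (Sym2 G.V)) := fun x y hxy =>
    ⟨(mem_edges _ _).1 (mem_pullback.1 (Finset.mem_coe.1 hxy)).1,
      (mem_pullback.1 (Finset.mem_coe.1 hxy)).2⟩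
  -- The walk is extended backwards along an ascending path. The next vertex w is recorded with its
  -- height, because this excludes reversals and makes the ranks increase.
  have key : ∀ u, H.s = u → u = H.r ∨ ∃ w, H.graph.Adj u w ∧ φ u < φ w ∧
      ∃ n, (G.rankProtocol ρ).Continues S n (g u) (g w) := by
    rintro u hu
    rw [hu] at hpath
    clear hu
    induction hpath using Relation.ReflTransGen.head_induction_on with
    | refl => exact Or.inl rfl
    | @head x y hxy _ ih =>
      obtain ⟨hxy, hlt⟩ := hxy
      obtain ⟨hxy, hS⟩ := hstep x y hxy
      refine Or.inr ⟨y, hxy, hlt, ?_⟩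
      rcases ih with rfl | ⟨w, hyw, hlt', n, hn⟩
      · refine ⟨_, hc.cons ⟨hadj _ _ hxy, hc.choose, hv x, ?_⟩ hS⟩
        rw [hρ _ _ hxy]
        exact (hφ.2.2.1 x).2.trans_lt hρv
      · refine ⟨_, hn.cons ⟨hadj _ _ hxy, hadj _ _ hyw, fun hxw => ?_, ?_⟩ hS⟩
        · have hxw' : x = w := hg hxw
          exact (hlt.trans hlt').ne (congrArg φ hxw')
        · rwa [hρ _ _ hxy, hρ _ _ hyw]
  rcases key H.s rfl with hsr | ⟨w, -, -, n, hn⟩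
  · exact absurd hsr H.s_ne_r
  · exact ⟨n, g w, hn⟩

namespace IsB0Expansion

variable {H₁ H₂ G : Network} {g₀ : Fin 7 → G.V} {g₁ : H₁.V → G.V} {g₂ : H₂.V → G.V}

theorem exists_protocol (h : IsB0Expansion H₁ H₂ G g₀ g₁ g₂) (hH₁ : H₁.IsSeriesParallel)
    (hH₂ : H₂.IsSeriesParallel) : ∃ A : G.Protocol, A.IsFinite ∧
      ∀ S ⊆ G.edges, EdgeConn (S : Set (Sym2 G.V)) G.s G.r → ¬ LostEvent g₀ g₁ g₂ S →
        ∃ W, A.IsWalk W ∧ ∀ e ∈ W.edges, e ∈ S := by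
  obtain ⟨φ₁, hφ₁⟩ := hH₁.exists_hasHeight
  obtain ⟨φ₂, hφ₂⟩ := hH₂.exists_hasHeight
  obtain ⟨ρ, hρ₁, hρ₂, hρ₀⟩ := h.exists_rank φ₁ φ₂
  refine ⟨G.rankProtocol ρ, isFinite_rankProtocol G ρ, fun S hS hconn hL => ?_⟩
  suffices hcont : ∃ n w, (G.rankProtocol ρ).Continues S n G.s w by
    obtain ⟨n, w, hn⟩ := hcont
    obtain ⟨W, hW, hWS, -⟩ := hn.exists_isWalk
    exact ⟨W, hW, hWS⟩
  have hadj₀ : ∀ x y, s(x, y) ∈ coreEdges → G.graph.Adj (g₀ x) (g₀ y) := fun x y hxy =>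
    (mem_edges _ _).1 ((h.mem_edges_iff s(g₀ x, g₀ y)).2 (Or.inl ⟨_, hxy, rfl⟩))
  have hadj₁ : ∀ x y, H₁.graph.Adj x y → G.graph.Adj (g₁ x) (g₁ y) := fun x y hxy =>
    (mem_edges _ _).1 ((h.mem_edges_iff s(g₁ x, g₁ y)).2
      (Or.inr (Or.inl ⟨s(x, y), (mem_edges _ _).2 hxy, rfl⟩)))
  have hadj₂ : ∀ x y, H₂.graph.Adj x y → G.graph.Adj (g₂ x) (g₂ y) := fun x y hxy =>
    (mem_edges _ _).1 ((h.mem_edges_iff s(g₂ x, g₂ y)).2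
      (Or.inr (Or.inr ⟨s(x, y), (mem_edges _ _).2 hxy, rfl⟩)))
  let good : Fin 7 → Fin 7 → Prop := fun x y =>
    ∃ n, (G.rankProtocol ρ).Continues S n (g₀ x) (g₀ y)
  have hT : ∀ x y, s(x, y) ∈ pullback coreEdges (Sym2.map g₀) S →
      s(x, y) ∈ coreEdges ∧ s(g₀ x, g₀ y) ∈ (S : Set (Sym2 G.V)) := fun x y hxy =>
    mem_pullback.1 hxy
  have hlast : ∀ x, s(x, 6) ∈ pullback coreEdges (Sym2.map g₀) S → good x 6 := by
    intro x hx
    obtain ⟨hx, hxS⟩ := hT x 6 hx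
    have hadj := hadj₀ x 6 hx
    change ∃ n, (G.rankProtocol ρ).Continues S n (g₀ x) (g₀ 6)
    rw [h.receiver] at hxS hadj ⊢
    exact ⟨0, .nil hadj hxS⟩
  have hstep : ∀ {x y z}, s(x, y) ∈ pullback coreEdges (Sym2.map g₀) S →
      (s(y, z) ∈ coreEdges ∧ x ≠ z ∧ dartRank x y < dartRank y z) → good y z → good x y := by
    rintro x y z hxy ⟨hyz, hne, hlt⟩ ⟨n, hn⟩
    obtain ⟨hxy, hxyS⟩ := hT x y hxy
    refine ⟨n + 1, hn.cons ⟨hadj₀ x y hxy, hadj₀ y z hyz, h.inj₀.ne hne, ?_⟩ hxyS⟩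
    rw [hρ₀ x y hxy, hρ₀ y z hyz]
    exact_mod_cast hlt
  have hstep' : ∀ {x y z}, s(y, x) ∈ pullback coreEdges (Sym2.map g₀) S →
      (s(y, z) ∈ coreEdges ∧ x ≠ z ∧ dartRank x y < dartRank y z) → good y z → good x y :=
    fun hxy => hstep (Sym2.eq_swap ▸ hxy)
  have hs₁ : g₁ H₁.s = G.s := by
    rw [← h.sender, (h.eq₀₁ 0 H₁.s).2 (Or.inl ⟨rfl, rfl⟩)]
  have hs₂ : g₂ H₂.s = G.s := by
    rw [← h.sender, (h.eq₀₂ 0 H₂.s).2 (Or.inl ⟨rfl, rfl⟩)]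
  have hr₁ : g₁ H₁.r = g₀ 1 := ((h.eq₀₁ 1 H₁.r).2 (Or.inr ⟨rfl, rfl⟩)).symm
  have hr₂ : g₂ H₂.r = g₀ 2 := ((h.eq₀₂ 2 H₂.r).2 (Or.inr ⟨rfl, rfl⟩)).symm
  -- Heights are at most 1, so a rank above 1 puts the directed edges leaving 1 after everything
  -- inside H₁.
  have hstart₁ : ∀ {y}, EdgeConn (pullback H₁.edges (Sym2.map g₁) S : Set (Sym2 H₁.V)) H₁.s H₁.r →
      (s(1, y) ∈ coreEdges ∧ y ≠ 0 ∧ y ≠ 1 ∧ 1 < dartRank 1 y) → good 1 y →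
      ∃ n w, (G.rankProtocol ρ).Continues S n G.s w := by
    rintro y hc ⟨hy, hy0, hy1, hlt⟩ ⟨n, hn⟩
    rw [← hs₁]
    rw [← hr₁] at hn
    refine exists_continues_sender hadj₁ hφ₁ h.inj₁ hρ₁ hc (fun x hx => ?_) ?_ hn
    · rw [eq_comm, h.eq₀₁] at hx
      tauto
    · rw [hr₁, hρ₀ _ _ hy]
      exact_mod_cast hlt
  have hstart₂ : ∀ {y}, EdgeConn (pullback H₂.edges (Sym2.map g₂) S : Set (Sym2 H₂.V)) H₂.s H₂.r →
      (s(2, y) ∈ coreEdges ∧ y ≠ 0 ∧ y ≠ 2 ∧ 1 < dartRank 2 y) → good 2 y →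
      ∃ n w, (G.rankProtocol ρ).Continues S n G.s w := by
    rintro y hc ⟨hy, hy0, hy2, hlt⟩ ⟨n, hn⟩
    rw [← hs₂]
    rw [← hr₂] at hn
    refine exists_continues_sender hadj₂ hφ₂ h.inj₂ hρ₂ hc (fun x hx => ?_) ?_ hn
    · rw [eq_comm, h.eq₀₂] at hx
      tauto
    · rw [hr₂, hρ₀ _ _ hy]
      exact_mod_cast hlt
  -- `dartRank` ascends along each of the eleven routes, for instance 4,5,6,7,10 on 2,5,3,1,4,r. On
  -- the sacrificed route 1,4,3,2,5,r it begins 7,8,3.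
  rcases h.exists_route hS hconn hL Iff.rfl Iff.rfl rfl with
    ⟨hc, h1, h2⟩ | ⟨hc, h1, h2, h3⟩ | ⟨hc, h1, h2, h3⟩ | ⟨hc, h1, h2, h3, h4⟩ |
    ⟨hc, h1, h2, h3, h4⟩ | ⟨hc, h1, h2⟩ | ⟨hc, h1, h2, h3⟩ | ⟨hc, h1, h2, h3⟩ |
    ⟨hc, h1, h2, h3, h4⟩ | ⟨hc, h1, h2, h3, h4⟩ | ⟨hc, h1, h2, h3, h4, h5⟩
  · exact hstart₁ hc (by decide) (hstep h1 (by decide) (hlast _ h2))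
  · exact hstart₁ hc (by decide) (hstep h1 (by decide) (hstep h2 (by decide) (hlast _ h3)))
  · exact hstart₁ hc (by decide) (hstep h1 (by decide) (hstep h2 (by decide) (hlast _ h3)))
  · exact hstart₁ hc (by decide) (hstep h1 (by decide) (hstep' h2 (by decide)
      (hstep h3 (by decide) (hlast _ h4))))
  · exact hstart₁ hc (by decide) (hstep h1 (by decide) (hstep' h2 (by decide)
      (hstep h3 (by decide) (hlast _ h4))))
  · exact hstart₂ hc (by decide) (hstep h1 (by decide) (hlast _ h2))
  · exact hstart₂ hc (by decide) (hstep h1 (by decide) (hstep h2 (by decide) (hlast _ h3)))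
  · exact hstart₂ hc (by decide) (hstep h1 (by decide) (hstep h2 (by decide) (hlast _ h3)))
  · exact hstart₂ hc (by decide) (hstep h1 (by decide) (hstep' h2 (by decide)
      (hstep h3 (by decide) (hlast _ h4))))
  · exact hstart₂ hc (by decide) (hstep h1 (by decide) (hstep' h2 (by decide)
      (hstep h3 (by decide) (hlast _ h4))))
  · exact hstart₂ hc (by decide) (hstep h1 (by decide) (hstep' h2 (by decide)
      (hstep' h3 (by decide) (hstep h4 (by decide) (hlast _ h5)))))

/-- A finite protocol with a walk in some state of the lost event has none in any state of the
mirrored event, and so loses all of the latter. The ascending protocol and its mirror image attain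
the two bounds. -/
theorem optimalReliability_eq (h : IsB0Expansion H₁ H₂ G g₀ g₁ g₂) (hH₁ : H₁.IsSeriesParallel)
    (hH₂ : H₂.IsSeriesParallel) {p : ℝ} (h0 : 0 ≤ p) (h1 : p ≤ 1) :
    G.optimalReliability (fun _ => p) = G.reliability (fun _ => p) -
      min (bernoulliProb G.edges p (LostEvent g₀ g₁ g₂))
        (bernoulliProb G.edges p (LostEvent (g₀ ∘ b0Mirror) g₂ g₁)) := by
  have hg := G.isGreatest_optimalReliability fun _ => p
  apply le_antisymm
  · obtain ⟨A, hA, hA'⟩ := hg.1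
    rw [← hA']
    by_cases hS : ∃ S ⊆ G.edges, LostEvent g₀ g₁ g₂ S ∧ ∃ W, A.IsWalk W ∧ ∀ e ∈ W.edges, e ∈ S
    · obtain ⟨S, hS, hL, W, hW, hWS⟩ := hS
      refine (protocolReliability_le h0 h1 (fun S => h.swap.edgeConn_of_lostEvent) ?_).trans
        (sub_le_sub_left (min_le_right _ _) _)
      rintro S' hS' hL' ⟨W', hW', hWS'⟩
      exact h.not_isFinite hS hS' hL hL' hW hWS hW' hWS' hA
    · push Not at hS
      refine (protocolReliability_le h0 h1 (fun S => h.edgeConn_of_lostEvent) ?_).trans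
        (sub_le_sub_left (min_le_left _ _) _)
      rintro S hS' hL ⟨W, hW, hWS⟩
      obtain ⟨e, he, he'⟩ := hS S hS' hL W hW
      exact he' (hWS e he)
  · obtain ⟨A, hA, hA'⟩ := h.exists_protocol hH₁ hH₂
    obtain ⟨B, hB, hB'⟩ := h.swap.exists_protocol hH₂ hH₁
    have h2 := (le_protocolReliability h0 h1 hA').trans (hg.2 ⟨A, hA, rfl⟩)
    have h3 := (le_protocolReliability h0 h1 hB').trans (hg.2 ⟨B, hB, rfl⟩)
    rcases min_choice (bernoulliProb G.edges p (LostEvent g₀ g₁ g₂))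
      (bernoulliProb G.edges p (LostEvent (g₀ ∘ b0Mirror) g₂ g₁)) with h4 | h4 <;> rw [h4]
    · exact h2
    · exact h3

end IsB0Expansion

end Network

/-! ### The main theorem -/

open Network Polynomial in
theorem mainTheorem1 (t : ℕ) (m : Fin t → ℕ) (hm : ∀ i, 0 < m i ∧ Odd (m i)) :
    ∃ H₁ H₂ G : Network,
      H₁.IsSeriesParallel ∧ H₂.IsSeriesParallel ∧
      HasProfile (fun p => H₁.reliability (fun _ => p) - H₂.reliability (fun _ => p)) m ∧
      G = Network.expandB0 H₁ H₂ ∧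
      IsPiecewisePolynomial (fun p => G.optimalReliability (fun _ => p)) ∧
      ∃ x : Fin t → ℝ, StrictMono x ∧
        {z | IsBreakpoint (fun p => G.optimalReliability (fun _ => p)) z} = Set.range x ∧
        ∀ i, IsBreakpointOfOrder (fun p => G.optimalReliability (fun _ => p)) (m i) (x i) := by
  obtain ⟨H₁, H₂, hH₁, hH₂, hprof⟩ := exists_hasProfile m fun i => (hm i).1
  have h := isB0Expansion_expandB0 H₁ H₂
  refine ⟨H₁, H₂, _, hH₁, hH₂, hprof, rfl, ?_⟩
  obtain ⟨q, hq0, hq, x, hx, hroot, hmult⟩ := hprof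
  obtain ⟨R, hR⟩ := exists_polynomial_bernoulliProb (expandB0 H₁ H₂).edges
    fun S => EdgeConn (S : Set (Sym2 (expandB0 H₁ H₂).V)) (expandB0 H₁ H₂).s (expandB0 H₁ H₂).r
  obtain ⟨r₁, hr₁⟩ := exists_polynomial_bernoulliProb H₁.edges
    fun S => EdgeConn (S : Set (Sym2 H₁.V)) H₁.s H₁.r
  obtain ⟨r₂, hr₂⟩ := exists_polynomial_bernoulliProb H₂.edges
    fun S => EdgeConn (S : Set (Sym2 H₂.V)) H₂.s H₂.r
  have hq' : r₁ - r₂ = q := by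
    refine Polynomial.eq_of_infinite_eval_eq _ _ ((Set.Ioo_infinite one_pos).mono fun p hp => ?_)
    have := hq p hp
    dsimp only at this
    rw [reliability_eq, reliability_eq, hr₁, hr₂] at this
    rw [Set.mem_ofPred_eq, eval_sub, this]
  have hf : ∀ p ∈ Set.Ioo (0 : ℝ) 1, (expandB0 H₁ H₂).optimalReliability (fun _ => p) =
      R.eval p - min ((X ^ 5 * (1 - X) ^ 3 * (r₁ * (1 - r₂))).eval p)
        ((X ^ 5 * (1 - X) ^ 3 * (r₂ * (1 - r₁))).eval p) := by
    intro p hp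
    rw [h.optimalReliability_eq hH₁ hH₂ hp.1.le hp.2.le, h.bernoulliProb_lostEvent,
      h.swap.bernoulliProb_lostEvent, reliability_eq, reliability_eq, reliability_eq, hR, hr₁, hr₂]
    simp
  -- The terms r₁r₂ cancel. The remaining factor in front of `q` has no zero in (0,1), so zeros and
  -- multiplicities there are those of `q`.
  have hD : X ^ 5 * (1 - X) ^ 3 * (r₁ * (1 - r₂)) - X ^ 5 * (1 - X) ^ 3 * (r₂ * (1 - r₁)) =
      X ^ 5 * (1 - X) ^ 3 * q := by
    rw [← hq']
    ring
  have hX : ∀ z ∈ Set.Ioo (0 : ℝ) 1, (X ^ 5 * (1 - X) ^ 3 : ℝ[X]).eval z ≠ 0 := by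
    intro z hz
    have h1 : 0 < 1 - z := by linarith [hz.2]
    have := mul_pos (pow_pos hz.1 5) (pow_pos h1 3)
    simpa using this.ne'
  have hD0 : X ^ 5 * (1 - X) ^ 3 * q ≠ 0 := by
    refine mul_ne_zero (fun h0 => hX (1 / 2) (by norm_num) ?_) hq0
    rw [h0, eval_zero]
  have hDroot : ∀ z ∈ Set.Ioo (0 : ℝ) 1, (X ^ 5 * (1 - X) ^ 3 * q).IsRoot z ↔ q.IsRoot z := by
    intro z hz
    rw [IsRoot.def, eval_mul, mul_eq_zero, or_iff_right (hX z hz), IsRoot.def]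
  have hxmem : ∀ i, x i ∈ Set.Ioo (0 : ℝ) 1 := fun i => (hroot.superset ⟨i, rfl⟩).1
  have hbreak : ∀ i, IsBreakpointOfOrder
      (fun p => (expandB0 H₁ H₂).optimalReliability (fun _ => p)) (m i) (x i) := by
    intro i
    refine isBreakpointOfOrder_sub_min (hxmem i) hf (hD ▸ hD0) ?_ (hm i).2
    rw [hD, rootMultiplicity_mul hD0, rootMultiplicity_eq_zero (hX _ (hxmem i)), zero_add, hmult]
  refine ⟨isPiecewisePolynomial_sub_min hf hx ?_, x, hx, ?_, hbreak⟩
  · rw [hD, ← hroot]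
    ext z
    exact and_congr_right fun hz => hDroot z hz
  · ext z
    constructor
    · intro hz
      have hz01 : z ∈ Set.Ioo (0 : ℝ) 1 := hz.choose_spec.1
      rw [← hroot]
      refine ⟨hz01, ?_⟩
      by_contra hn
      refine not_isBreakpoint_sub_min hz01 hf ?_ hz
      rwa [hD, hDroot z hz01]
    · rintro ⟨i, rfl⟩
      exact ⟨m i, hbreak i⟩
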